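/- Let $g>0$, $L>0$, and let $U,H\in C^1([0,L])$ be real functions with $H(x)>0$ and $|U(x)|/\sqrt{gH(x)}<1$ for all $x\in[0,L]$ (subcritical background flow; constant $U,H$ are included). Put $$M=\begin{bmatrix}U&H\\ g&U\end{bmatrix},\qquad W=\begin{bmatrix}g&U\\ U&H\end{bmatrix},\qquad \|q\|_W^2=\int_0^L q^TWq\,dx .$$ Let $\alpha_1,\alpha_2,\beta_1,\beta_2\ge 0$ with $(\alpha_1,\alpha_2)\ne(0,0)$ and $(\beta_1,\beta_2)\ne(0,0)$. For $q=(h,u)^T$ consider the linear vector-invariant shallow water problem $$\frac{\partial q}{\partial t}=-\frac{\partial (Mq)}{\partial x}+G,\qquad q(\cdot,0)=f,\qquad \alpha_1F_1+\alpha_2F_2=0 \text{ at } x=0,\qquad \beta_1F_1-\beta_2F_2=0\text{ at }x=L,$$ with fluxes $F=Mq$, i.e. $F_1=Uh+Hu$ and $F_2=gh+Uu$, where $f\in L^2([0,L];\mathbb R^2)$ and $G:[0,T]\to L^2([0,L];\mathbb R^2)$ is strongly measurable and bounded. A solution on $[0,T]$ is a function $q\in C([0,T];L^2([0,L];\mathbb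 R^2))$ with $q(0)=f$ for which there are flux traces $F|_0,F|_L\in L^2(0,T;\mathbb R^2)$, satisfying the two boundary conditions for almost every time, such that for every $\varphi\in C^\infty(\mathbb R)$, $i\in\{1,2\}$ and $t\in[0,T]$ $$\int_0^L q_i(t)\varphi\,dx=\int_0^L f_i\varphi\,dx+\int_0^t\Big(\int_0^L F_i(\tau)\varphi'\,dx+\int_0^L G_i(\tau)\varphi\,dx+F_i|_0(\tau)\varphi(0)-F_i|_L(\tau)\varphi(L)\Big)d\tau .$$ Then the problem is strongly well-posed: there are constants $K>0$ and $\mu\in\mathbb R$ such that for all $T>0$, $f$ and $G$ as above there is a unique solution $q$ on $[0,T]$, and for all $t\in[0,T]$ $$\|q(t)\|_W\le K e^{\mu t}\Big(\|f\|_W+\sup_{\tau\in[0,t]}\|G(\cdot,\tau)\|_W\Big).$$ Moreover, for every solution, the boundary term $\mathrm{BT}=F_1F_2|_0-F_1F_2|_L$ satisfies $\mathrm{BT}\le 0$ for almost every time, and for every $t\in[0,T]$ this estimate holds with $$K=\max\Big(1,\frac{1-e^{-\mu t}}{\mu}\Big)\qquad(K=\max(1,t)\text{ if }\mu=0)$$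 for every real $\mu$ such that $\mathrm{BT}(\tau)/\|q(\tau)\|_W^2\le\mu$ for almost every $\tau\in[0,t]$ with $q(\tau)\ne 0$; in particular with $\mu=0$, and with $\mu=\max_{\tau\in[0,t]}\mathrm{BT}/\|q\|_W^2\le 0$ where this maximum exists. -/

import Mathlib

open Set MeasureTheory
open scoped Matrix ContDiff

noncomputable section

namespace LinearSWE

/-- The space `L²([0,L]; ℝ²)` of states `q = (h, u)`; `h` is component `0`, `u` is component `1`. -/
abbrev State (L : ℝ) : Type :=
  Lp (EuclideanSpace ℝ (Fin 2)) 2 (volume.restrict (Icc (0 : ℝ) L))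

/-- The coefficient matrix `M(x)` of the linear flux. -/
def fluxMatrix (g : ℝ) (U H : ℝ → ℝ) (x : ℝ) : Matrix (Fin 2) (Fin 2) ℝ :=
  !![U x, H x; g, U x]

/-- The weight matrix `W(x)`. -/
def weightMatrix (g : ℝ) (U H : ℝ → ℝ) (x : ℝ) : Matrix (Fin 2) (Fin 2) ℝ :=
  !![g, U x; U x, H x]

/-- The linear flux `F = M q`, that is `F₁ = U h + H u` (component `0`) and
`F₂ = g h + U u` (component `1`), as a function of `x`. -/
def flux (g : ℝ) (U H : ℝ → ℝ) {L : ℝ} (q : State L) (x : ℝ) : Fin 2 → ℝ :=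
  fluxMatrix g U H x *ᵥ (q x).ofLp

/-- The weighted inner product `(p, q)_W = ∫₀ᴸ pᵀ W q dx`. -/
def wInner (g : ℝ) (U H : ℝ → ℝ) {L : ℝ} (p q : State L) : ℝ :=
  ∫ x in Icc (0 : ℝ) L, (p x).ofLp ⬝ᵥ (weightMatrix g U H x *ᵥ (q x).ofLp)

/-- The weighted norm `‖q‖_W`. -/
def wNorm (g : ℝ) (U H : ℝ → ℝ) {L : ℝ} (q : State L) : ℝ :=
  √(wInner g U H q q)

/-- Admissible forcing on `[0,T]`: a strongly measurable and bounded function of time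
with values in `L²([0,L]; ℝ²)`. -/
structure IsForcing (g : ℝ) (U H : ℝ → ℝ) {L : ℝ} (T : ℝ) (G : ℝ → State L) : Prop where
  aestronglyMeasurable : AEStronglyMeasurable G (volume.restrict (Icc 0 T))
  bddAbove : BddAbove ((fun τ => wNorm g U H (G τ)) '' Icc 0 T)

/-- The supremum of `‖G(·,τ)‖_W` over `τ ∈ [0,t]` (the maximum, if it is attained). -/
def forcingSup (g : ℝ) (U H : ℝ → ℝ) {L : ℝ} (G : ℝ → State L) (t : ℝ) : ℝ :=
  sSup ((fun τ => wNorm g U H (G τ)) '' Icc 0 t)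

/-- `q` is a weak solution on `[0,L] × [0,T]` of `∂q/∂t = -∂(M q)/∂x + G`, `q(·,0) = f`,
with `α₁ F₁ + α₂ F₂ = 0` at `x = 0` and `β₁ F₁ - β₂ F₂ = 0` at `x = L`.
Here `q` is continuous in time with values in `L²`; the functions `F0` and `FL` of time are
the traces of the flux `F = M q` at `x = 0` and at `x = L`. They are pinned down by the weak
form, in which the test functions do not have to vanish at the end points. -/
structure IsWeakSolution (g L : ℝ) (U H : ℝ → ℝ) (α₁ α₂ β₁ β₂ T : ℝ)
    (f : State L) (G : ℝ → State L) (q : ℝ → State L) (F0 FL : ℝ → Fin 2 → ℝ) : Prop where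
  continuousOn : ContinuousOn q (Icc 0 T)
  initial : q 0 = f
  trace_zero : ∀ i, MemLp (fun τ => F0 τ i) 2 (volume.restrict (Icc 0 T))
  trace_L : ∀ i, MemLp (fun τ => FL τ i) 2 (volume.restrict (Icc 0 T))
  weak_form : ∀ φ : ℝ → ℝ, ContDiff ℝ ∞ φ → ∀ i : Fin 2, ∀ t ∈ Icc 0 T,
    ∫ x in Icc (0 : ℝ) L, q t x i * φ x =
      (∫ x in Icc (0 : ℝ) L, f x i * φ x) +
      ∫ τ in (0 : ℝ)..t,
        ((∫ x in Icc (0 : ℝ) L, flux g U H (q τ) x i * deriv φ x) +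
          (∫ x in Icc (0 : ℝ) L, G τ x i * φ x) +
          F0 τ i * φ 0 - FL τ i * φ L)
  bc_zero : ∀ᵐ τ ∂(volume.restrict (Icc 0 T)), α₁ * F0 τ 0 + α₂ * F0 τ 1 = 0
  bc_L : ∀ᵐ τ ∂(volume.restrict (Icc 0 T)), β₁ * FL τ 0 - β₂ * FL τ 1 = 0

/-- `q` is a weak solution on `[0,T]` (for some, then almost everywhere unique, flux traces). -/
def IsSolution (g L : ℝ) (U H : ℝ → ℝ) (α₁ α₂ β₁ β₂ T : ℝ)
    (f : State L) (G : ℝ → State L) (q : ℝ → State L) : Prop :=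
  ∃ F0 FL : ℝ → Fin 2 → ℝ, IsWeakSolution g L U H α₁ α₂ β₁ β₂ T f G q F0 FL

/-- The boundary term `BT = F₁ F₂ |₀ - F₁ F₂ |_L` as a function of time. -/
def boundaryTerm (F0 FL : ℝ → Fin 2 → ℝ) (τ : ℝ) : ℝ :=
  F0 τ 0 * F0 τ 1 - FL τ 0 * FL τ 1

/-- The factor `K = max(1, (1 - e^{-μt})/μ)`, which for `μ = 0` is `max(1, t)`. -/
def growthFactor (μ t : ℝ) : ℝ :=
  if μ = 0 then max 1 t else max 1 ((1 - Real.exp (-μ * t)) / μ)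

/-- Strong well-posedness: for all initial data and forcing there is one and only one solution,
and it satisfies the energy estimate, with constants independent of the data (and of the final
time). -/
def StronglyWellPosed (g L : ℝ) (U H : ℝ → ℝ) (α₁ α₂ β₁ β₂ : ℝ) : Prop :=
  ∃ K > (0 : ℝ), ∃ μ : ℝ, ∀ T > (0 : ℝ), ∀ (f : State L) (G : ℝ → State L),
    IsForcing g U H T G →
    ∃ q : ℝ → State L, IsSolution g L U H α₁ α₂ β₁ β₂ T f G q ∧
      (∀ p : ℝ → State L, IsSolution g L U H α₁ α₂ β₁ β₂ T f G p → EqOn p q (Icc 0 T)) ∧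
      ∀ t ∈ Icc 0 T, wNorm g U H (q t) ≤
        K * Real.exp (μ * t) * (wNorm g U H f + forcingSup g U H G t)

end LinearSWE

end

/-!
Exchanging the components of the flux `F = M w` gives `W w`. Hence `v = ∂F/∂x` has
`⟨W v, w⟩ = ∫ (F₁' F₂ + F₂' F₁) = F₁ F₂|_L - F₁ F₂|₀`, so the energy `‖q‖_W ^ 2` of a solution
changes only through the boundary term `BT` and the forcing. The boundary conditions make `BT ≤ 0`,
both for the spatial operator and for its adjoint.

The spatial operator is treated as a closed linear relation `D` between a state `w`, its image
`v = ∂F/∂x` and the boundary values `z` of `F`. A second multiplier, the symmetric matrix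
`(2 x / L - 1) diag(g, H) M`, bounds the boundary values of a solution, square integrated in time,
by its data. By the two estimates the graph of the map from data to classical solutions and their
boundary values has a closure that is the graph of a bounded map. Already the separated solutions
`φ(t) w`, with `w` in the domain, have dense data: if `(P, p)` is orthogonal to these data, then
the second primitive of `p`, with time reversed, solves the homogeneous adjoint problem, whose
accretivity makes it vanish. So the closure provides a solution for all data, together with its
energy identity.

The weak formulation says precisely that the time integrals of a solution belong to `D`. The time
integral of the difference of two solutions with the same data solves the homogeneous problem in
the classical sense, so its energy is nonincreasing and vanishes. By this uniqueness every weak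
solution inherits the energy identity, and Grönwall's inequality for `‖q‖_W` gives the estimate.
-/

noncomputable section

namespace LinearSWE

section IntervalTools

variable {E : Type*} [NormedAddCommGroup E] {L : ℝ}

theorem intervalIntegrable_of_Icc {f : ℝ → E} {x : ℝ} (hx : x ∈ Icc 0 L)
    (hf : IntegrableOn f (Icc 0 L)) : IntervalIntegrable f volume 0 x := by
  rw [intervalIntegrable_iff_integrableOn_Ioc_of_le hx.1]
  exact hf.mono_set (Ioc_subset_Icc_self.trans (Icc_subset_Icc_right hx.2))

variable [NormedSpace ℝ E]

theorem integral_Icc_eq (hL : 0 ≤ L) (f : ℝ → E) :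
    ∫ x in Icc 0 L, f x = ∫ x in (0 : ℝ)..L, f x := by
  rw [integral_Icc_eq_integral_Ioc, intervalIntegral.integral_of_le hL]

theorem intervalIntegral_congr_Icc {f h : ℝ → E} {x : ℝ} (hx : x ∈ Icc 0 L)
    (hf : ∀ᵐ y ∂(volume.restrict (Icc 0 L)), f y = h y) :
    ∫ y in (0 : ℝ)..x, f y = ∫ y in (0 : ℝ)..x, h y := by
  apply intervalIntegral.integral_congr_ae
  filter_upwards [(ae_restrict_iff' measurableSet_Icc).1 hf] with y hy hy'
  rw [uIoc_of_le hx.1] at hy'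
  exact hy ⟨hy'.1.le, hy'.2.trans hx.2⟩

theorem continuousOn_primitive_Icc {f : ℝ → E} (hf : IntegrableOn f (Icc 0 L)) :
    ContinuousOn (fun x => ∫ y in (0 : ℝ)..x, f y) (Icc 0 L) := by
  rcases le_or_gt 0 L with hL | hL
  · have := intervalIntegral.continuousOn_primitive_interval (μ := volume) (a := 0) (b := L)
      (f := f) (by rwa [uIcc_of_le hL])
    rwa [uIcc_of_le hL] at this
  · simp [Icc_eq_empty hL.not_ge]

theorem integral_to_right_eq_sub {f : ℝ → E} {x : ℝ} (hf : IntegrableOn f (Icc 0 L))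
    (hx : x ∈ Icc 0 L) :
    ∫ y in x..L, f y = (∫ y in (0 : ℝ)..L, f y) - ∫ y in (0 : ℝ)..x, f y :=
  (intervalIntegral.integral_interval_sub_left
    (intervalIntegrable_of_Icc (right_mem_Icc.2 (hx.1.trans hx.2)) hf)
    (intervalIntegrable_of_Icc hx hf)).symm

theorem continuousOn_integral_to_right {f : ℝ → E} (hf : IntegrableOn f (Icc 0 L)) :
    ContinuousOn (fun x => ∫ y in x..L, f y) (Icc 0 L) :=
  (continuousOn_const.sub (continuousOn_primitive_Icc hf)).congr fun _ hx =>
    integral_to_right_eq_sub hf hx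

theorem ae_eq_zero_of_primitive_eq_zero [CompleteSpace E] {u : ℝ → E}
    (hu : IntegrableOn u (Icc 0 L)) (h : ∀ x ∈ Icc 0 L, ∫ y in (0 : ℝ)..x, u y = 0) :
    ∀ᵐ x ∂(volume.restrict (Icc 0 L)), u x = 0 := by
  rw [← Measure.restrict_congr_set Ioo_ae_eq_Icc, ae_restrict_iff' measurableSet_Ioo]
  rcases le_or_gt L 0 with hL | hL
  · simp [Ioo_eq_empty hL.not_gt]
  have hu := intervalIntegrable_of_Icc (right_mem_Icc.2 hL.le) hu
  filter_upwards [hu.ae_hasDerivAt_integral] with x hx hxm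
  have hx' := hx (by rw [uIcc_of_le hL.le]; exact Ioo_subset_Icc_self hxm) 0 (by simp)
  refine hx'.unique ((hasDerivAt_const x (0 : E)).congr_of_eventuallyEq ?_)
  filter_upwards [Ioo_mem_nhds hxm.1 hxm.2] with z hz
  exact h z (Ioo_subset_Icc_self hz)

end IntervalTools

section WeakDerivative

theorem integral_mul_primitive_add_primitive_mul {u v : ℝ → ℝ} {c L : ℝ} (a b : ℝ)
    (hu : IntervalIntegrable u volume c L) (hv : IntervalIntegrable v volume c L) :
    ∫ x in c..L, (u x * (b + ∫ y in c..x, v y) + (a + ∫ y in c..x, u y) * v x) =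
      (a + ∫ y in c..L, u y) * (b + ∫ y in c..L, v y) - a * b := by
  have hac : ∀ {w : ℝ → ℝ} (d : ℝ), IntervalIntegrable w volume c L →
      AbsolutelyContinuousOnInterval (fun x => d + ∫ y in c..x, w y) c L := fun d hw =>
    (contDiffOn_const (n := 1)).absolutelyContinuousOnInterval.add
      (hw.absolutelyContinuousOnInterval_intervalIntegral (by simp))
  have key := (hac a hu).integral_deriv_mul_eq_sub (hac b hv)
  simp only [intervalIntegral.integral_same, add_zero] at key
  rw [← key]
  apply intervalIntegral.integral_congr_ae
  filter_upwards [hu.ae_hasDerivAt_integral, hv.ae_hasDerivAt_integral] with x h1 h2 hx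
  have hx' := uIoc_subset_uIcc hx
  rw [((h1 hx' c (by simp)).const_add a).deriv, ((h2 hx' c (by simp)).const_add b).deriv]

theorem exists_contDiff_primitive {ψ : ℝ → ℝ} (hψ : ContDiff ℝ ∞ ψ) :
    ∃ φ : ℝ → ℝ, ContDiff ℝ ∞ φ ∧ deriv φ = ψ := by
  have hd : ∀ x, HasDerivAt (fun x => ∫ y in (0 : ℝ)..x, ψ y) (ψ x) x := fun x =>
    (hψ.continuous.integral_hasStrictDerivAt 0 x).hasDerivAt
  have hderiv : deriv (fun x => ∫ y in (0 : ℝ)..x, ψ y) = ψ := funext fun x => (hd x).deriv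
  refine ⟨_, contDiff_infty_iff_deriv.2 ⟨fun x => (hd x).differentiableAt, ?_⟩, hderiv⟩
  rwa [hderiv]

theorem eq_add_integral_deriv {φ : ℝ → ℝ} (hφ : ContDiff ℝ ∞ φ) (x : ℝ) :
    φ x = φ 0 + ∫ y in (0 : ℝ)..x, deriv φ y := by
  rw [intervalIntegral.integral_deriv_eq_sub
    (fun x _ => (hφ.differentiable (by simp)).differentiableAt)
    ((hφ.continuous_deriv (by simp)).intervalIntegrable _ _), add_sub_cancel]

/-- `F` has the weak derivative `v` on `[0, L]` and the boundary values `a` at `0` and `b` at `L`.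
The test functions need not vanish at the end points, so that the boundary values are part of the
weak formulation. -/
def HasWeakDeriv (L : ℝ) (F v : ℝ → ℝ) (a b : ℝ) : Prop :=
  ∀ φ : ℝ → ℝ, ContDiff ℝ ∞ φ →
    (∫ x in Icc 0 L, F x * deriv φ x) + (∫ x in Icc 0 L, v x * φ x) + a * φ 0 - b * φ L = 0

variable {F v F' v' : ℝ → ℝ} {L a b a' b' : ℝ}

theorem HasWeakDeriv.mul_const (h : HasWeakDeriv L F v a b) (c : ℝ) :
    HasWeakDeriv L (fun x => F x * c) (fun x => v x * c) (a * c) (b * c) := fun φ hφ => by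
  simp only [mul_right_comm _ c, integral_mul_const]
  linear_combination c * h φ hφ

theorem HasWeakDeriv.congr_ae (h : HasWeakDeriv L F v a b)
    (hF : ∀ᵐ x ∂(volume.restrict (Icc 0 L)), F' x = F x)
    (hv : ∀ᵐ x ∂(volume.restrict (Icc 0 L)), v' x = v x) : HasWeakDeriv L F' v' a b :=
  fun φ hφ => by
    rw [integral_congr_ae (hF.mono fun x hx => congrArg (· * deriv φ x) hx),
      integral_congr_ae (hv.mono fun x hx => congrArg (· * φ x) hx), h φ hφ]

theorem hasWeakDeriv_primitive (hL : 0 ≤ L) (hv : IntegrableOn v (Icc 0 L)) (a : ℝ) :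
    HasWeakDeriv L (fun x => a + ∫ y in (0 : ℝ)..x, v y) v a (a + ∫ y in (0 : ℝ)..L, v y) := by
  intro φ hφ
  have hv' := intervalIntegrable_of_Icc (right_mem_Icc.2 hL) hv
  have hd : IntervalIntegrable (deriv φ) volume 0 L :=
    (hφ.continuous_deriv (by simp)).intervalIntegrable _ _
  have hV : ContinuousOn (fun x => a + ∫ y in (0 : ℝ)..x, v y) (uIcc 0 L) :=
    continuousOn_const.add (uIcc_of_le hL ▸ continuousOn_primitive_Icc hv)
  have key := integral_mul_primitive_add_primitive_mul a (φ 0) hv' hd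
  simp only [← eq_add_integral_deriv hφ] at key
  rw [intervalIntegral.integral_add (hv'.mul_continuousOn hφ.continuous.continuousOn)
    (hd.continuousOn_mul hV)] at key
  simp only [integral_Icc_eq hL]
  linarith

theorem hasWeakDeriv_of_contDiff (hL : 0 ≤ L) {φ : ℝ → ℝ} (hφ : ContDiff ℝ ∞ φ) :
    HasWeakDeriv L φ (deriv φ) (φ 0) (φ L) := by
  have h := hasWeakDeriv_primitive hL
    (hφ.continuous_deriv (by simp)).continuousOn.integrableOn_Icc (φ 0)
  simpa only [← eq_add_integral_deriv hφ] using h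

theorem HasWeakDeriv.boundary_eq (hL : 0 ≤ L) (h : HasWeakDeriv L F v a b) :
    b = a + ∫ x in (0 : ℝ)..L, v x := by
  have := h (fun _ => 1) contDiff_const
  simp only [deriv_const', mul_zero, integral_zero, mul_one, zero_add] at this
  rw [← integral_Icc_eq hL]
  linarith

theorem HasWeakDeriv.ae_eq_primitive (hL : 0 ≤ L) (hF : IntegrableOn F (Icc 0 L))
    (hv : IntegrableOn v (Icc 0 L)) (h : HasWeakDeriv L F v a b) :
    ∀ᵐ x ∂(volume.restrict (Icc 0 L)), F x = a + ∫ y in (0 : ℝ)..x, v y := by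
  have hV : ContinuousOn (fun x => a + ∫ y in (0 : ℝ)..x, v y) (Icc 0 L) :=
    continuousOn_const.add (continuousOn_primitive_Icc hv)
  refine ae_eq_of_integral_contDiff_smul_eq (Integrable.locallyIntegrable hF)
    (Integrable.locallyIntegrable hV.integrableOn_Icc) fun ψ hψ _ => ?_
  obtain ⟨φ, hφ, rfl⟩ := exists_contDiff_primitive hψ
  have h1 := h φ hφ
  have h2 := hasWeakDeriv_primitive hL hv a φ hφ
  rw [← h.boundary_eq hL] at h2
  simp only [smul_eq_mul, mul_comm (deriv φ _)]
  linarith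

theorem HasWeakDeriv.ae_eq_zero_of_ae_eq_zero (hv : IntegrableOn v (Icc 0 L))
    (h : HasWeakDeriv L F v a b) (hF : ∀ᵐ x ∂(volume.restrict (Icc 0 L)), F x = 0) :
    ∀ᵐ x ∂(volume.restrict (Icc 0 L)), v x = 0 := by
  rw [← Measure.restrict_congr_set Ioo_ae_eq_Icc, ae_restrict_iff' measurableSet_Ioo]
  refine isOpen_Ioo.ae_eq_zero_of_integral_contDiff_smul_eq_zero
    (hv.mono_set Ioo_subset_Icc_self).locallyIntegrableOn fun φ hφ _ hsupp => ?_
  have h0 : φ 0 = 0 := image_eq_zero_of_notMem_tsupport fun h => lt_irrefl _ (hsupp h).1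
  have hL : φ L = 0 := image_eq_zero_of_notMem_tsupport fun h => lt_irrefl _ (hsupp h).2
  have hFφ : ∫ x in Icc 0 L, F x * deriv φ x = 0 :=
    integral_eq_zero_of_ae (hF.mono fun x hx => by simp [hx])
  rw [← setIntegral_eq_integral_of_forall_compl_eq_zero (s := Icc 0 L) fun x hx => by
    rw [image_eq_zero_of_notMem_tsupport fun h => hx (Ioo_subset_Icc_self (hsupp h)), zero_smul]]
  simpa [h0, hL, hFφ, mul_comm] using h φ hφ

theorem HasWeakDeriv.integral_mul_add_mul (hL : 0 ≤ L) (hF : IntegrableOn F (Icc 0 L))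
    (hv : IntegrableOn v (Icc 0 L)) (hF' : IntegrableOn F' (Icc 0 L))
    (hv' : IntegrableOn v' (Icc 0 L)) (h : HasWeakDeriv L F v a b)
    (h' : HasWeakDeriv L F' v' a' b') :
    ∫ x in Icc 0 L, (v x * F' x + F x * v' x) = b * b' - a * a' := by
  have hLm := right_mem_Icc.2 hL
  rw [h.boundary_eq hL, h'.boundary_eq hL, ← integral_mul_primitive_add_primitive_mul a a'
    (intervalIntegrable_of_Icc hLm hv) (intervalIntegrable_of_Icc hLm hv'), ← integral_Icc_eq hL]
  refine integral_congr_ae ?_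
  filter_upwards [h.ae_eq_primitive hL hF hv, h'.ae_eq_primitive hL hF' hv'] with x hx hx'
  rw [hx, hx']

theorem HasWeakDeriv.integral_weight_mul_sq (hL : 0 ≤ L) (hF : IntegrableOn F (Icc 0 L))
    (hv : IntegrableOn v (Icc 0 L)) (h : HasWeakDeriv L F v a b) {c c' : ℝ → ℝ}
    (hc : ∀ x ∈ Icc 0 L, c x = c 0 + ∫ y in (0 : ℝ)..x, c' y) (hc' : IntegrableOn c' (Icc 0 L)) :
    ∫ x in Icc 0 L, (c' x * F x ^ 2 + 2 * (c x * F x * v x)) = c L * b ^ 2 - c 0 * a ^ 2 := by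
  have hLm := right_mem_Icc.2 hL
  set V : ℝ → ℝ := fun x => a + ∫ y in (0 : ℝ)..x, v y
  have hV : ContinuousOn V (Icc 0 L) := continuousOn_const.add (continuousOn_primitive_Icc hv)
  have hi : IntegrableOn (fun x => v x * V x + V x * v x) (Icc 0 L) :=
    (hv.mul_continuousOn hV isCompact_Icc).add (hv.continuousOn_mul hV isCompact_Icc)
  have hsq : ∀ x ∈ Icc 0 L, V x ^ 2 = a ^ 2 + ∫ y in (0 : ℝ)..x, (v y * V y + V y * v y) := by
    intro x hx
    rw [integral_mul_primitive_add_primitive_mul a a (intervalIntegrable_of_Icc hx hv)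
      (intervalIntegrable_of_Icc hx hv)]
    ring
  have key := integral_mul_primitive_add_primitive_mul (c 0) (a ^ 2)
    (intervalIntegrable_of_Icc hLm hc') (intervalIntegrable_of_Icc hLm hi)
  rw [← hc L hLm, ← hsq L hLm] at key
  rw [h.boundary_eq hL, ← key, ← integral_Icc_eq hL]
  refine integral_congr_ae ?_
  filter_upwards [h.ae_eq_primitive hL hF hv, ae_restrict_mem measurableSet_Icc] with x hx hxm
  rw [← hc x hxm, ← hsq x hxm, hx]
  ring

-- Subtracting from a test function its affine interpolant reduces to test functions that vanish
-- at the end points.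
theorem exists_hasWeakDeriv (hL : 0 < L) (hF : IntegrableOn F (Icc 0 L))
    (hv : IntegrableOn v (Icc 0 L))
    (h : ∀ φ : ℝ → ℝ, ContDiff ℝ ∞ φ → φ 0 = 0 → φ L = 0 →
      (∫ x in Icc 0 L, F x * deriv φ x) + ∫ x in Icc 0 L, v x * φ x = 0) :
    ∃ a b, HasWeakDeriv L F v a b := by
  refine ⟨(∫ x in Icc 0 L, F x) / L - ∫ x in Icc 0 L, v x * (1 - x / L),
    (∫ x in Icc 0 L, F x) / L + ∫ x in Icc 0 L, v x * (x / L), fun φ hφ => ?_⟩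
  have hmul : ∀ {u ψ : ℝ → ℝ}, IntegrableOn u (Icc 0 L) → Continuous ψ →
      Integrable (fun x => u x * ψ x) (volume.restrict (Icc 0 L)) := fun hu hψ =>
    hu.mul_continuousOn hψ.continuousOn isCompact_Icc
  have hφ' : Continuous (deriv φ) := hφ.continuous_deriv (by simp)
  have hdiff := hφ.differentiable (by simp)
  have hd : ∀ x, deriv (fun x => φ x - (φ 0 * (1 - x / L) + φ L * (x / L))) x =
      deriv φ x - (φ L - φ 0) / L := by
    intro x
    refine ((hdiff x).hasDerivAt.sub ((((hasDerivAt_id x).div_const L).const_sub 1).const_mul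
      (φ 0) |>.add (((hasDerivAt_id x).div_const L).const_mul (φ L)))).deriv.trans ?_
    ring
  have key := h (fun x => φ x - (φ 0 * (1 - x / L) + φ L * (x / L))) (by fun_prop)
    (by simp) (by simp [hL.ne'])
  have e1 : ∫ x in Icc 0 L, F x * (deriv φ x - (φ L - φ 0) / L) =
      (∫ x in Icc 0 L, F x * deriv φ x) - (∫ x in Icc 0 L, F x) * ((φ L - φ 0) / L) := by
    rw [← integral_mul_const, ← integral_sub (hmul hF hφ') (hF.mul_const _)]
    simp only [mul_sub]
  have e2 : ∫ x in Icc 0 L, v x * (φ x - (φ 0 * (1 - x / L) + φ L * (x / L))) =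
      (∫ x in Icc 0 L, v x * φ x) - ((∫ x in Icc 0 L, v x * (1 - x / L)) * φ 0 +
        (∫ x in Icc 0 L, v x * (x / L)) * φ L) := by
    have h1 := hmul (ψ := fun x => 1 - x / L) hv (by fun_prop)
    have h2 := hmul (ψ := fun x => x / L) hv (by fun_prop)
    rw [← integral_mul_const, ← integral_mul_const, ← integral_add (h1.mul_const _)
      (h2.mul_const _), ← integral_sub (hmul hv hφ.continuous)
      ((h1.mul_const _).fun_add (h2.mul_const _))]
    congr 1 with x
    ring
  simp only [hd] at key
  rw [e1, e2] at key
  linear_combination key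

end WeakDerivative

section Gronwall

theorem continuous_gronwallBound_add (K x : ℝ) (δ S : ℝ) :
    Continuous fun ε => gronwallBound (δ + ε) K (S + ε) x := by
  by_cases hK : K = 0
  · simp only [gronwallBound_K0, hK]
    fun_prop
  · simp only [gronwallBound_of_K_ne_0 hK]
    fun_prop

theorem gronwallBound_pos {δ K ε x : ℝ} (hδ : 0 < δ) (hε : 0 ≤ ε) (hx : 0 ≤ x) :
    0 < gronwallBound δ K ε x := by
  rcases lt_trichotomy K 0 with hK | rfl | hK
  · rw [gronwallBound_of_K_ne_0 hK.ne]
    have h : 0 ≤ ε / K * (Real.exp (K * x) - 1) :=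
      mul_nonneg_of_nonpos_of_nonpos (div_nonpos_of_nonneg_of_nonpos hε hK.le)
        (sub_nonpos.2 (Real.exp_le_one_iff.2 (mul_nonpos_of_nonpos_of_nonneg hK.le hx)))
    positivity
  · rw [gronwallBound_K0]
    positivity
  · rw [gronwallBound_of_K_ne_0 hK.ne']
    have h : 0 ≤ ε / K * (Real.exp (K * x) - 1) :=
      mul_nonneg (by positivity) (sub_nonneg.2 (Real.one_le_exp (by positivity)))
    positivity

theorem frequently_slope_lt_of_sub_le_integral {y φ : ℝ → ℝ} {x t r : ℝ}
    (hφ : ContinuousOn φ (Icc x t)) (hxt : x < t)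
    (h : ∀ z ∈ Icc x t, y z - y x ≤ ∫ τ in x..z, φ τ) (hr : φ x < r) :
    ∃ᶠ z in nhdsWithin x (Ioi x), slope y x z < r := by
  have hmem : Icc x t ∈ nhdsWithin x (Ioi x) := Icc_mem_nhdsGT hxt
  have hd : HasDerivWithinAt (fun z => ∫ τ in x..z, φ τ) (φ x) (Ici x) x :=
    intervalIntegral.integral_hasDerivWithinAt_right (by simp) (t := Ioi x)
      ⟨Icc x t, hmem, hφ.aestronglyMeasurable measurableSet_Icc⟩
      ((hφ x (left_mem_Icc.2 hxt.le)).mono_of_mem_nhdsWithin hmem)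
  have hslope := (hasDerivWithinAt_iff_tendsto_slope' (lt_irrefl x)).1 hd.Ioi_of_Ici
  have hz : ∀ᶠ z in nhdsWithin x (Ioi x), z ∈ Ioc x t := Ioc_mem_nhdsGT hxt
  have hlt : ∀ᶠ z in nhdsWithin x (Ioi x), slope (fun z => ∫ τ in x..z, φ τ) x z < r :=
    hslope.eventually (Iio_mem_nhds hr)
  refine (hlt.and hz).frequently.mono ?_
  rintro z ⟨hz, hzx, hzt⟩
  refine lt_of_le_of_lt ?_ hz
  simp only [slope_def_field, intervalIntegral.integral_same, sub_zero]
  have := h z ⟨hzx.le, hzt⟩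
  have := sub_pos.2 hzx
  gcongr

theorem sqrt_le_gronwallBound {y : ℝ → ℝ} {t μ S : ℝ} (ht : 0 ≤ t) (hS : 0 ≤ S)
    (hy : ContinuousOn y (Icc 0 t)) (hy0 : 0 ≤ y 0)
    (h : ∀ s ∈ Icc 0 t, ∀ s' ∈ Icc s t,
      y s' - y s ≤ ∫ τ in s..s', (2 * μ * y τ + 2 * S * √(y τ))) :
    √(y t) ≤ gronwallBound (√(y 0)) μ S t := by
  have hφ : ContinuousOn (fun τ => 2 * μ * y τ + 2 * S * √(y τ)) (Icc 0 t) := by fun_prop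
  have key : ∀ ε > 0, √(y t) ≤ gronwallBound (√(y 0) + ε) μ (S + ε) t := by
    intro ε hε
    set B : ℝ → ℝ := gronwallBound (√(y 0) + ε) μ (S + ε)
    have hBpos : ∀ x, 0 ≤ x → 0 < B x := fun x hx =>
      gronwallBound_pos (by positivity) (by positivity) hx
    refine (Real.sqrt_le_left (hBpos t ht).le).2 (image_le_of_liminf_slope_right_lt_deriv_boundary
      (f' := fun τ => 2 * μ * y τ + 2 * S * √(y τ)) (B := fun x => B x ^ 2)
      (B' := fun x => 2 * B x * (μ * B x + (S + ε))) hy ?_ ?_ ?_ ?_ (right_mem_Icc.2 ht))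
    · exact fun x hx r hr => frequently_slope_lt_of_sub_le_integral
        (hφ.mono (Icc_subset_Icc_left hx.1)) hx.2 (h x ⟨hx.1, hx.2.le⟩) hr
    · have hB0 : B 0 = √(y 0) + ε := gronwallBound_x0 _ _ _
      rw [hB0]
      nlinarith [Real.sqrt_nonneg (y 0), Real.sq_sqrt hy0]
    · intro x
      convert! (hasDerivAt_gronwallBound (√(y 0) + ε) μ (S + ε) x).pow 2 using 1
      simp [B]
    · intro x hx hyx
      have hp := hBpos x hx.1
      simp only [hyx, Real.sqrt_sq hp.le]
      nlinarith
  have hlim : Filter.Tendsto (fun ε => gronwallBound (√(y 0) + ε) μ (S + ε) t)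
      (nhdsWithin 0 (Ioi 0)) (nhds (gronwallBound (√(y 0)) μ S t)) := by
    have := (continuous_gronwallBound_add μ t (√(y 0)) S).tendsto 0
    simp only [add_zero] at this
    exact this.mono_left nhdsWithin_le_nhds
  exact ge_of_tendsto hlim (eventually_nhdsWithin_of_forall key)

theorem gronwallBound_le_growthFactor {δ μ S t : ℝ} (hδ : 0 ≤ δ) (hS : 0 ≤ S) :
    gronwallBound δ μ S t ≤ growthFactor μ t * Real.exp (μ * t) * (δ + S) := by
  by_cases hμ : μ = 0
  · simp only [hμ, gronwallBound_K0, growthFactor, if_true, zero_mul, Real.exp_zero, mul_one]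
    nlinarith [le_max_left 1 t, le_max_right 1 t]
  · simp only [gronwallBound_of_K_ne_0 hμ, growthFactor, if_neg hμ]
    set k := (1 - Real.exp (-μ * t)) / μ with hk
    have hfactor : δ * Real.exp (μ * t) + S / μ * (Real.exp (μ * t) - 1) =
        (δ + k * S) * Real.exp (μ * t) := by
      have hexp : Real.exp (μ * t) * Real.exp (-μ * t) = 1 := by
        rw [← Real.exp_add, neg_mul, add_neg_cancel, Real.exp_zero]
      rw [hk]
      rw [neg_mul] at hexp ⊢
      field_simp
      linear_combination S * hexp
    have hle : δ + k * S ≤ max 1 k * (δ + S) := by nlinarith [le_max_left 1 k, le_max_right 1 k]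
    rw [hfactor, mul_right_comm]
    exact mul_le_mul_of_nonneg_right hle (Real.exp_pos _).le

end Gronwall

section LpTwo

variable {α E : Type*} [MeasurableSpace α] {μ : Measure α} [NormedAddCommGroup E]

theorem norm_Lp_two_sq (p : Lp E 2 μ) : ‖p‖ ^ 2 = ∫ x, ‖p x‖ ^ 2 ∂μ := by
  have hp := Lp.aestronglyMeasurable p
  rw [Lp.norm_def, toReal_eLpNorm hp,
    lpNorm_eq_integral_norm_rpow_toReal two_ne_zero ENNReal.ofNat_ne_top hp]
  simp only [ENNReal.toReal_ofNat, Real.rpow_ofNat]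
  rw [inv_eq_one_div, ← Real.sqrt_eq_rpow, Real.sq_sqrt (by positivity)]

theorem integral_norm_le_Lp_two [IsFiniteMeasure μ] (p : Lp E 2 μ) :
    ∫ x, ‖p x‖ ∂μ ≤ √(μ.real univ) * ‖p‖ := by
  have hp := Lp.aestronglyMeasurable p
  have h := eLpNorm_le_eLpNorm_mul_rpow_measure_univ (p := 1) (q := 2) (by norm_num) hp
  rw [← lpNorm_one_eq_integral_norm hp, ← toReal_eLpNorm hp, mul_comm, Lp.norm_def,
    Real.sqrt_eq_rpow, measureReal_def, ENNReal.toReal_rpow, ← ENNReal.toReal_mul]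
  refine ENNReal.toReal_mono (ENNReal.mul_ne_top (Lp.eLpNorm_ne_top p) (by finiteness)) ?_
  convert h using 3
  norm_num

theorem norm_fst_add_integral_norm_snd_le {F : Type*} [NormedAddCommGroup F] {T : ℝ} (hT : 0 ≤ T)
    (d : WithLp 2 (F × Lp E 2 (volume.restrict (Icc 0 T)))) :
    ‖d.fst‖ + ∫ τ in Icc 0 T, ‖d.snd τ‖ ≤ (1 + √T) * ‖d‖ := by
  have h := integral_norm_le_Lp_two d.snd
  rw [measureReal_restrict_apply_univ, Real.volume_real_Icc_of_le hT, sub_zero] at h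
  have h1 := WithLp.norm_fst_le (p := 2) _ d
  have h2 := mul_le_mul_of_nonneg_left (WithLp.norm_snd_le (p := 2) _ d) (Real.sqrt_nonneg T)
  linarith

theorem memLp_of_continuousOn {f : ℝ → E} {a b : ℝ} (p : ENNReal) (hf : ContinuousOn f (Icc a b)) :
    MemLp f p (volume.restrict (Icc a b)) := by
  obtain ⟨C, hC⟩ := isCompact_Icc.exists_bound_of_continuousOn hf
  exact MemLp.of_bound (hf.aestronglyMeasurable measurableSet_Icc) C
    ((ae_restrict_iff' measurableSet_Icc).2 (.of_forall hC))

end LpTwo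

section FunctionalAnalysis

variable {E F : Type*} [NormedAddCommGroup E] [NormedSpace ℝ E] [NormedAddCommGroup F]
  [NormedSpace ℝ F]

theorem integral_mem_of_isClosed [CompleteSpace E] {α : Type*} [MeasurableSpace α] {μ : Measure α}
    {D : Submodule ℝ E} (hD : IsClosed (D : Set E)) {f : α → E} (hf : Integrable f μ)
    (h : ∀ᵐ x ∂μ, f x ∈ D) : ∫ x, f x ∂μ ∈ D := by
  have : IsClosed (D : Set E) := hD
  have h0 : D.mkQL (∫ x, f x ∂μ) = 0 := by
    rw [← D.mkQL.integral_comp_comm hf]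
    refine integral_eq_zero_of_ae ?_
    filter_upwards [h] with x hx
    simpa using hx
  simpa using h0

theorem exists_mem_closure_of_dense_image_fst [CompleteSpace E] [CompleteSpace F]
    {Γ : Submodule ℝ (E × F)} {C : NNReal} (hC : ∀ p ∈ Γ, ‖p.2‖ ≤ C * ‖p.1‖)
    (hd : Dense (Prod.fst '' (Γ : Set (E × F)))) (d : E) :
    ∃ y, (d, y) ∈ closure (Γ : Set (E × F)) := by
  have hbound : ∀ p ∈ Γ.topologicalClosure, ‖p.2‖ ≤ C * ‖p.1‖ := fun p hp =>
    closure_minimal (t := {p : E × F | ‖p.2‖ ≤ C * ‖p.1‖}) hC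
      (isClosed_le (by fun_prop) (by fun_prop)) hp
  have : CompleteSpace Γ.topologicalClosure :=
    (Submodule.isClosed_topologicalClosure _).completeSpace_coe
  set π := (ContinuousLinearMap.fst ℝ E F).comp Γ.topologicalClosure.subtypeL
  have hπ : AntilipschitzWith (1 + C) π := by
    refine π.antilipschitz_of_bound fun p => ?_
    have h1 := hbound p p.2
    have h2 : 0 ≤ ‖(p : E × F).1‖ := norm_nonneg _
    have h3 : 0 ≤ C * ‖(p : E × F).1‖ := by positivity
    change ‖(p : E × F)‖ ≤ (1 + C) * ‖(p : E × F).1‖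
    exact norm_prod_le_iff.2 ⟨by linarith, by linarith⟩
  have hrange : Dense (range π) := by
    refine hd.mono ?_
    rintro _ ⟨p, hp, rfl⟩
    exact ⟨⟨p, Γ.le_topologicalClosure hp⟩, rfl⟩
  obtain ⟨p, rfl⟩ : d ∈ range π := by
    rw [← (hπ.isClosed_range π.uniformContinuous).closure_eq]
    exact hrange d
  exact ⟨p.1.2, p.2⟩

variable {α : Type*} [MeasurableSpace α] {μ : Measure α} {G : Type*} [NormedAddCommGroup G]
  [NormedSpace ℝ G]

theorem continuous_setIntegral_bilin (B : E →L[ℝ] F →L[ℝ] G) (s : Set α) :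
    Continuous fun p : Lp E 2 μ × Lp F 2 μ => ∫ x in s, B (p.1 x) (p.2 x) ∂μ := by
  have h : Continuous fun p : Lp E 2 μ × Lp F 2 μ => B.holderL μ 2 2 1 p.1 p.2 := by fun_prop
  refine ((continuous_setIntegral s).comp h).congr fun p => ?_
  exact integral_congr_ae (ae_restrict_of_ae (B.coeFn_holder (r := 1) p.1 p.2))

theorem continuous_setIntegral_Lp [IsFiniteMeasure μ] (s : Set α) :
    Continuous fun p : Lp E 2 μ => ∫ x in s, p x ∂μ := by
  have h : Continuous fun p : Lp E 2 μ => (indicatorConstLp 2 MeasurableSet.univ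
    (measure_ne_top μ _) (1 : ℝ), p) := by fun_prop
  refine ((continuous_setIntegral_bilin (ContinuousLinearMap.lsmul ℝ ℝ) s).comp h).congr
    fun p => ?_
  refine integral_congr_ae (ae_restrict_of_ae ?_)
  filter_upwards [indicatorConstLp_coeFn (μ := μ) (p := 2) (hs := MeasurableSet.univ)
    (hμs := measure_ne_top μ _) (c := (1 : ℝ))] with x hx
  rw [indicator_univ] at hx
  change indicatorConstLp 2 MeasurableSet.univ (measure_ne_top μ _) (1 : ℝ) x • p x = p x
  rw [hx, one_smul]

theorem intervalIntegral_eq_setIntegral_restrict {T t : ℝ} (ht : t ∈ Icc 0 T) (f : ℝ → E) :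
    ∫ τ in (0 : ℝ)..t, f τ = ∫ τ in Ioc 0 t, f τ ∂(volume.restrict (Icc 0 T)) := by
  rw [intervalIntegral.integral_of_le ht.1, Measure.restrict_restrict measurableSet_Ioc,
    inter_eq_left.2 (Ioc_subset_Icc_self.trans (Icc_subset_Icc_right ht.2))]

end FunctionalAnalysis

section SymmetricOperator

variable {X : Type*} [NormedAddCommGroup X] [InnerProductSpace ℝ X] {A : X →L[ℝ] X}

theorem hasDerivAt_inner_apply_self (hA : (A : X →ₗ[ℝ] X).IsSymmetric) {q : ℝ → X} {r : X} {t : ℝ}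
    (hq : HasDerivAt q r t) :
    HasDerivAt (fun t => inner ℝ (A (q t)) (q t)) (2 * inner ℝ (A r) (q t)) t := by
  refine ((A.hasFDerivAt.comp_hasDerivAt t hq).inner ℝ hq).congr_deriv ?_
  have h : inner ℝ (A (q t)) r = inner ℝ (A r) (q t) := by
    rw [real_inner_comm]
    exact (hA r (q t)).symm
  change inner ℝ (A (q t)) r + inner ℝ (A r) (q t) = _
  rw [h, two_mul]

theorem inner_apply_self_sub_eq_integral (hA : (A : X →ₗ[ℝ] X).IsSymmetric) {q r : ℝ → X}
    (hq : ∀ t, HasDerivAt q (r t) t) (hr : Continuous r) (t : ℝ) :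
    inner ℝ (A (q t)) (q t) - inner ℝ (A (q 0)) (q 0) =
      ∫ τ in (0 : ℝ)..t, 2 * inner ℝ (A (r τ)) (q τ) := by
  have hqc : Continuous q := continuous_iff_continuousAt.2 fun t => (hq t).continuousAt
  exact (intervalIntegral.integral_eq_sub_of_hasDerivAt
    (fun τ _ => hasDerivAt_inner_apply_self hA (hq τ))
    (Continuous.intervalIntegrable (by fun_prop) _ _)).symm

theorem eqOn_zero_of_inner_primitive_nonpos [CompleteSpace X] (hA : (A : X →ₗ[ℝ] X).IsSymmetric)
    (hpos : ∀ x, inner ℝ (A x) x ≤ 0 → x = 0) {r : ℝ → X} {T : ℝ} (hT : 0 < T)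
    (hr : ContinuousOn r (Icc 0 T))
    (h : ∀ t ∈ Icc 0 T, inner ℝ (A (r t)) (∫ τ in (0 : ℝ)..t, r τ) ≤ 0) :
    EqOn r 0 (Icc 0 T) := by
  set R := IccExtend hT.le ((Icc 0 T).domRestrict r)
  have hRr : ∀ t ∈ Icc 0 T, R t = r t := fun t ht => IccExtend_of_mem hT.le _ ht
  have hR : Continuous R := hr.domRestrict.Icc_extend'
  have hint : ∀ t ∈ Icc 0 T, ∫ τ in (0 : ℝ)..t, R τ = ∫ τ in (0 : ℝ)..t, r τ := fun t ht =>
    intervalIntegral_congr_Icc ht ((ae_restrict_mem measurableSet_Icc).mono hRr)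
  have hzero : ∀ t ∈ Icc 0 T, ∫ τ in (0 : ℝ)..t, r τ = 0 := by
    intro t ht
    have key := inner_apply_self_sub_eq_integral hA
      (fun t => (hR.integral_hasStrictDerivAt 0 t).hasDerivAt) hR t
    rw [intervalIntegral.integral_same, map_zero, inner_zero_left, sub_zero] at key
    rw [← hint t ht]
    refine hpos _ (key.trans_le ?_)
    rw [← neg_nonneg, ← intervalIntegral.integral_neg]
    refine intervalIntegral.integral_nonneg ht.1 fun τ hτ => ?_
    have hτT : τ ∈ Icc 0 T := Icc_subset_Icc_right ht.2 hτ
    have := h τ hτT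
    rw [hint τ hτT, hRr τ hτT]
    linarith
  exact Measure.eqOn_Icc_of_ae_eq _ hT.ne
    (ae_eq_zero_of_primitive_eq_zero hr.integrableOn_Icc hzero) hr continuousOn_const

end SymmetricOperator

section EvolutionSystem

variable {X Z : Type*} [NormedAddCommGroup X] [InnerProductSpace ℝ X] [NormedAddCommGroup Z]
  [NormedSpace ℝ Z]

/-- An abstract first order operator with boundary values. A triple `(w, v, z) ∈ D` stands for a
state `w` of the domain, its image `v`, and the boundary values `z` of `w`; the boundary
conditions are part of `D`. The operator `S` defines the energy `⟪S w, w⟫`, and the form `B` the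
flux of energy through the boundary. Both the operator and its adjoint are accretive for the
energy, and the boundary values are controlled by a multiplier `N`. -/
structure IsAccretiveSystem (D : Submodule ℝ (X × X × Z)) (S : X ≃L[ℝ] X)
    (B : Z →L[ℝ] Z →L[ℝ] ℝ) : Prop where
  isClosed : IsClosed (D : Set (X × X × Z))
  isSymmetric : ((S : X →L[ℝ] X) : X →ₗ[ℝ] X).IsSymmetric
  coercive : ∃ c > 0, ∀ x, c * ‖x‖ ^ 2 ≤ inner ℝ (S x) x
  green : ∀ w v z, (w, v, z) ∈ D → inner ℝ (S v) w = B z z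
  form_nonneg : ∀ w v z, (w, v, z) ∈ D → 0 ≤ B z z
  adjoint_accretive : ∀ P Q, (∀ w v z, (w, v, z) ∈ D → inner ℝ P w = -inner ℝ Q v) →
    inner ℝ (S.symm P) Q ≤ 0
  dense_domain : ∀ P, (∀ w v z, (w, v, z) ∈ D → inner ℝ P w = 0) → P = 0
  trace_bound : ∃ (N : X →L[ℝ] X) (C : ℝ), (N : X →ₗ[ℝ] X).IsSymmetric ∧
    ∀ w v z, (w, v, z) ∈ D → ‖z‖ ^ 2 ≤ 2 * inner ℝ (N v) w + C * ‖w‖ ^ 2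

/-- A solution `q` of `q' + A q = G` on `[0, T]`, where `A` is the operator described by `D`, which
is continuously differentiable with derivative `r` and has continuous boundary values `z`. -/
structure IsClassicalSolution (D : Submodule ℝ (X × X × Z)) (T : ℝ) (G q r : ℝ → X)
    (z : ℝ → Z) : Prop where
  continuous_forcing : Continuous G
  continuous_deriv : Continuous r
  continuous_trace : Continuous z
  hasDerivAt : ∀ t, HasDerivAt q (r t) t
  mem : ∀ t ∈ Icc 0 T, (q t, G t - r t, z t) ∈ D

/-- A solution of `q' + A q = G`, `q 0 = f` in the time-integrated sense, with boundary values `z`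
that are square integrable in time. -/
structure IsMildSolution (D : Submodule ℝ (X × X × Z)) (T : ℝ) (f : X) (G q : ℝ → X)
    (z : ℝ → Z) : Prop where
  continuousOn : ContinuousOn q (Icc 0 T)
  initial : q 0 = f
  memLp_trace : MemLp z 2 (volume.restrict (Icc 0 T))
  mem : ∀ t ∈ Icc 0 T, (∫ τ in (0 : ℝ)..t, q τ, f - q t + ∫ τ in (0 : ℝ)..t, G τ,
    ∫ τ in (0 : ℝ)..t, z τ) ∈ D

variable {D : Submodule ℝ (X × X × Z)} {T : ℝ} {G q r : ℝ → X} {z : ℝ → Z}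

theorem IsClassicalSolution.continuous (h : IsClassicalSolution D T G q r z) : Continuous q :=
  continuous_iff_continuousAt.2 fun t => (h.hasDerivAt t).continuousAt

theorem IsClassicalSolution.zero : IsClassicalSolution D T 0 0 0 0 where
  continuous_forcing := continuous_zero
  continuous_deriv := continuous_zero
  continuous_trace := continuous_zero
  hasDerivAt t := hasDerivAt_const t 0
  mem t _ := by
    simp only [Pi.zero_apply, sub_zero]
    exact D.zero_mem

theorem IsClassicalSolution.add {G' q' r' : ℝ → X} {z' : ℝ → Z}
    (h : IsClassicalSolution D T G q r z) (h' : IsClassicalSolution D T G' q' r' z') :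
    IsClassicalSolution D T (G + G') (q + q') (r + r') (z + z') where
  continuous_forcing := h.continuous_forcing.add h'.continuous_forcing
  continuous_deriv := h.continuous_deriv.add h'.continuous_deriv
  continuous_trace := h.continuous_trace.add h'.continuous_trace
  hasDerivAt t := (h.hasDerivAt t).add (h'.hasDerivAt t)
  mem t ht := by simpa [add_sub_add_comm] using D.add_mem (h.mem t ht) (h'.mem t ht)

theorem IsClassicalSolution.smul (c : ℝ) (h : IsClassicalSolution D T G q r z) :
    IsClassicalSolution D T (c • G) (c • q) (c • r) (c • z) where
  continuous_forcing := h.continuous_forcing.const_smul c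
  continuous_deriv := h.continuous_deriv.const_smul c
  continuous_trace := h.continuous_trace.const_smul c
  hasDerivAt t := (h.hasDerivAt t).const_smul c
  mem t ht := by simpa [smul_sub] using D.smul_mem c (h.mem t ht)

theorem isClassicalSolution_separated {w v : X} {z : Z} (h : (w, v, z) ∈ D) {η : ℝ → ℝ}
    (hη : ContDiff ℝ ∞ η) :
    IsClassicalSolution D T (fun t => deriv η t • w + η t • v) (fun t => η t • w)
      (fun t => deriv η t • w) (fun t => η t • z) where
  continuous_forcing := ((hη.continuous_deriv (by simp)).smul continuous_const).add
    (hη.continuous.smul continuous_const)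
  continuous_deriv := (hη.continuous_deriv (by simp)).smul continuous_const
  continuous_trace := hη.continuous.smul continuous_const
  hasDerivAt t := (hη.differentiable (by simp) t).hasDerivAt.smul_const w
  mem t _ := by simpa using D.smul_mem (η t) h

theorem IsClassicalSolution.integral_mem [CompleteSpace X] [CompleteSpace Z]
    (h : IsClassicalSolution D T G q r z) (hD : IsClosed (D : Set (X × X × Z))) {t : ℝ}
    (ht : t ∈ Icc 0 T) :
    (∫ τ in (0 : ℝ)..t, q τ, q 0 - q t + ∫ τ in (0 : ℝ)..t, G τ, ∫ τ in (0 : ℝ)..t, z τ) ∈ D := by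
  have hG := h.continuous_forcing
  have hr := h.continuous_deriv
  have iq : IntegrableOn q (Ioc 0 t) := h.continuous.integrableOn_Ioc
  have iv : IntegrableOn (fun τ => G τ - r τ) (Ioc 0 t) := (hG.sub hr).integrableOn_Ioc
  have iz : IntegrableOn z (Ioc 0 t) := h.continuous_trace.integrableOn_Ioc
  have key := integral_mem_of_isClosed hD (iq.prodMk (iv.prodMk iz))
    ((ae_restrict_mem measurableSet_Ioc).mono fun τ hτ => h.mem τ ⟨hτ.1.le, hτ.2.trans ht.2⟩)
  rw [integral_pair iq (iv.prodMk iz), integral_pair iv iz,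
    ← intervalIntegral.integral_of_le ht.1, ← intervalIntegral.integral_of_le ht.1,
    ← intervalIntegral.integral_of_le ht.1, intervalIntegral.integral_sub
      (hG.intervalIntegrable _ _) (hr.intervalIntegrable _ _),
    intervalIntegral.integral_eq_sub_of_hasDerivAt (fun τ _ => h.hasDerivAt τ)
      (hr.intervalIntegrable _ _)] at key
  convert key using 3
  abel

variable {S : X ≃L[ℝ] X} {B : Z →L[ℝ] Z →L[ℝ] ℝ}

theorem IsClassicalSolution.energy_eq (h : IsClassicalSolution D T G q r z)
    (hD : IsAccretiveSystem D S B) {t : ℝ} (ht : t ∈ Icc 0 T) :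
    inner ℝ (S (q t)) (q t) - inner ℝ (S (q 0)) (q 0) =
      ∫ τ in (0 : ℝ)..t, (2 * inner ℝ (S (G τ)) (q τ) - 2 * B (z τ) (z τ)) := by
  refine (inner_apply_self_sub_eq_integral hD.isSymmetric h.hasDerivAt h.continuous_deriv t).trans
    (intervalIntegral.integral_congr fun τ hτ => ?_)
  rw [uIcc_of_le ht.1] at hτ
  have := hD.green _ _ _ (h.mem τ ⟨hτ.1, hτ.2.trans ht.2⟩)
  simp only [map_sub, inner_sub_left] at this
  simp only [ContinuousLinearEquiv.coe_coe]
  linarith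

theorem IsAccretiveSystem.eq_zero_of_inner_nonpos (hD : IsAccretiveSystem D S B) {x : X}
    (hx : inner ℝ (S x) x ≤ 0) : x = 0 := by
  obtain ⟨c, hc, h⟩ := hD.coercive
  have := (h x).trans hx
  have : ‖x‖ ^ 2 ≤ 0 := nonpos_of_mul_nonpos_right this hc
  simpa using this

theorem inner_apply_le (A : X →L[ℝ] X) (x y : X) : inner ℝ (A x) y ≤ ‖A‖ * ‖x‖ * ‖y‖ :=
  (real_inner_le_norm _ _).trans (mul_le_mul_of_nonneg_right (A.le_opNorm x) (norm_nonneg y))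

theorem integral_inner_apply_le (A : X →L[ℝ] X) (hG : Continuous G) (hq : Continuous q) {t m : ℝ}
    (ht : t ∈ Icc 0 T) (hm : ∀ τ ∈ Icc 0 T, ‖q τ‖ ≤ m) :
    ∫ τ in (0 : ℝ)..t, inner ℝ (A (G τ)) (q τ) ≤ ‖A‖ * m * ∫ τ in (0 : ℝ)..T, ‖G τ‖ := by
  have hm0 : 0 ≤ m := (norm_nonneg _).trans (hm t ht)
  rw [← intervalIntegral.integral_const_mul]
  refine (intervalIntegral.integral_mono_on ht.1 (Continuous.intervalIntegrable (by fun_prop) _ _)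
    (Continuous.intervalIntegrable (by fun_prop) _ _) fun τ hτ => ?_).trans
    (intervalIntegral.integral_mono_interval le_rfl ht.1 ht.2
      (.of_forall fun τ => by positivity) (Continuous.intervalIntegrable (by fun_prop) _ _))
  have := mul_le_mul_of_nonneg_left (hm τ ⟨hτ.1, hτ.2.trans ht.2⟩)
    (by positivity : 0 ≤ ‖A‖ * ‖G τ‖)
  linarith [inner_apply_le A (G τ) (q τ)]

theorem IsClassicalSolution.energy_le (h : IsClassicalSolution D T G q r z)
    (hD : IsAccretiveSystem D S B) {t : ℝ} (ht : t ∈ Icc 0 T) :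
    inner ℝ (S (q t)) (q t) ≤ inner ℝ (S (q 0)) (q 0) +
      2 * ∫ τ in (0 : ℝ)..t, inner ℝ (S (G τ)) (q τ) := by
  have hq := h.continuous
  have hG := h.continuous_forcing
  have hz := h.continuous_trace
  rw [← sub_le_iff_le_add', h.energy_eq hD ht, ← intervalIntegral.integral_const_mul]
  refine intervalIntegral.integral_mono_on ht.1 (Continuous.intervalIntegrable (by fun_prop) _ _)
    (Continuous.intervalIntegrable (by fun_prop) _ _) fun τ hτ => ?_
  linarith [hD.form_nonneg _ _ _ (h.mem τ ⟨hτ.1, hτ.2.trans ht.2⟩)]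

theorem exists_forall_norm_le (hD : IsAccretiveSystem D S B) :
    ∃ K ≥ 0, ∀ {T : ℝ} {G q r : ℝ → X} {z : ℝ → Z}, 0 ≤ T → IsClassicalSolution D T G q r z →
      ∀ t ∈ Icc 0 T, ‖q t‖ ≤ K * (‖q 0‖ + ∫ τ in (0 : ℝ)..T, ‖G τ‖) := by
  obtain ⟨c, hc, hcoer⟩ := hD.coercive
  set s := ‖(S : X →L[ℝ] X)‖
  refine ⟨2 * s / c, by positivity, fun {T G q r z} hT h => ?_⟩
  obtain ⟨t, ht, hmax⟩ :=
    isCompact_Icc.exists_isMaxOn (nonempty_Icc.2 hT) h.continuous.norm.continuousOn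
  refine fun τ hτ => le_trans (hmax hτ) (b := ‖q t‖) ?_
  set J := ∫ τ in (0 : ℝ)..T, ‖G τ‖
  have hJ : 0 ≤ J := intervalIntegral.integral_nonneg hT fun _ _ => norm_nonneg _
  have hforce := integral_inner_apply_le (S : X →L[ℝ] X) h.continuous_forcing h.continuous ht hmax
  have hinit : inner ℝ (S (q 0)) (q 0) ≤ 2 * s * ‖q t‖ * ‖q 0‖ := by
    have h1 := inner_apply_le (S : X →L[ℝ] X) (q 0) (q 0)
    have h2 := mul_le_mul_of_nonneg_left (hmax (left_mem_Icc.2 hT)) (by positivity : 0 ≤ s * ‖q 0‖)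
    have h3 : 0 ≤ s * ‖q 0‖ * ‖q t‖ := by positivity
    simp only [ContinuousLinearEquiv.coe_coe] at h1
    linarith
  have hm : ‖q t‖ * (c * ‖q t‖) ≤ ‖q t‖ * (2 * s * (‖q 0‖ + J)) := by
    have := h.energy_le hD ht
    have := hcoer (q t)
    simp only [ContinuousLinearEquiv.coe_coe] at hforce
    linarith
  rcases (norm_nonneg (q t)).eq_or_lt with h0 | h0
  · rw [← h0]
    positivity
  · rw [div_mul_eq_mul_div, le_div_iff₀ hc]
    linarith [le_of_mul_le_mul_left hm h0]

theorem IsClassicalSolution.integral_norm_trace_sq_le (h : IsClassicalSolution D T G q r z)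
    (hT : 0 ≤ T) {N : X →L[ℝ] X} (hN : (N : X →ₗ[ℝ] X).IsSymmetric) {C m : ℝ}
    (htrace : ∀ w v z, (w, v, z) ∈ D → ‖z‖ ^ 2 ≤ 2 * inner ℝ (N v) w + C * ‖w‖ ^ 2)
    (hm : ∀ τ ∈ Icc 0 T, ‖q τ‖ ≤ m) :
    ∫ τ in (0 : ℝ)..T, ‖z τ‖ ^ 2 ≤ 2 * (∫ τ in (0 : ℝ)..T, inner ℝ (N (G τ)) (q τ)) -
      (inner ℝ (N (q T)) (q T) - inner ℝ (N (q 0)) (q 0)) + T * (|C| * m ^ 2) := by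
  have hq := h.continuous
  have hG := h.continuous_forcing
  have hr := h.continuous_deriv
  have hz := h.continuous_trace
  have hpoint : ∀ τ ∈ Icc 0 T, ‖z τ‖ ^ 2 ≤
      2 * inner ℝ (N (G τ)) (q τ) - 2 * inner ℝ (N (r τ)) (q τ) + |C| * m ^ 2 := by
    intro τ hτ
    have h1 := htrace _ _ _ (h.mem τ hτ)
    have h2 : C * ‖q τ‖ ^ 2 ≤ |C| * m ^ 2 := by
      gcongr
      exacts [le_abs_self C, hm τ hτ]
    simp only [map_sub, inner_sub_left] at h1
    linarith
  have hint := intervalIntegral.integral_mono_on (μ := volume) hT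
    (Continuous.intervalIntegrable (by fun_prop) _ _)
    (Continuous.intervalIntegrable (by fun_prop) _ _) hpoint
  rwa [intervalIntegral.integral_add (Continuous.intervalIntegrable (by fun_prop) _ _) (by simp),
    intervalIntegral.integral_sub (Continuous.intervalIntegrable (by fun_prop) _ _)
      (Continuous.intervalIntegrable (by fun_prop) _ _),
    ← inner_apply_self_sub_eq_integral hN h.hasDerivAt hr, intervalIntegral.integral_const_mul,
    intervalIntegral.integral_const, sub_zero, smul_eq_mul] at hint

theorem exists_integral_norm_trace_sq_le (hD : IsAccretiveSystem D S B) (hT : 0 ≤ T) :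
    ∃ K ≥ 0, ∀ {G q r : ℝ → X} {z : ℝ → Z}, IsClassicalSolution D T G q r z →
      ∫ τ in (0 : ℝ)..T, ‖z τ‖ ^ 2 ≤ (K * (‖q 0‖ + ∫ τ in (0 : ℝ)..T, ‖G τ‖)) ^ 2 := by
  obtain ⟨K, hK0, hK⟩ := exists_forall_norm_le hD
  obtain ⟨N, C, hN, htrace⟩ := hD.trace_bound
  refine ⟨√(2 * ‖N‖ * K + 2 * ‖N‖ * K ^ 2 + T * |C| * K ^ 2), by positivity,
    fun {G q r z} h => ?_⟩
  have hTm := right_mem_Icc.2 hT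
  have hmax := hK hT h
  have hint := h.integral_norm_trace_sq_le hT hN htrace hmax
  have hforce := integral_inner_apply_le N h.continuous_forcing h.continuous hTm hmax
  set J := ∫ τ in (0 : ℝ)..T, ‖G τ‖
  have hJ : 0 ≤ J := intervalIntegral.integral_nonneg hT fun _ _ => norm_nonneg _
  set a := ‖q 0‖ + J
  have hend : ∀ τ ∈ Icc 0 T, |inner ℝ (N (q τ)) (q τ)| ≤ ‖N‖ * (K * a) ^ 2 := by
    intro τ hτ
    have h1 := (abs_real_inner_le_norm _ _).trans
      (mul_le_mul_of_nonneg_right (N.le_opNorm (q τ)) (norm_nonneg (q τ)))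
    have h2 : ‖N‖ * ‖q τ‖ ^ 2 ≤ ‖N‖ * (K * a) ^ 2 := by
      gcongr
      exact hmax τ hτ
    linarith
  have h0 := abs_le.1 (hend 0 (left_mem_Icc.2 hT))
  have h1 := abs_le.1 (hend T hTm)
  have h2 : ‖N‖ * (K * a) * J ≤ ‖N‖ * (K * a) * a := by
    gcongr
    exact le_add_of_nonneg_left (norm_nonneg _)
  rw [mul_pow, Real.sq_sqrt (by positivity)]
  linarith [h0.2, h1.1]

end EvolutionSystem

section Density

variable {X Z : Type*} [NormedAddCommGroup X] [InnerProductSpace ℝ X] [NormedAddCommGroup Z]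
  [NormedSpace ℝ Z] {D : Submodule ℝ (X × X × Z)} {S : X ≃L[ℝ] X}
  {B : Z →L[ℝ] Z →L[ℝ] ℝ} {T : ℝ} {p : ℝ → X} {P₀ : X}

theorem IsAccretiveSystem.isSymmetric_symm (hD : IsAccretiveSystem D S B) :
    ((S.symm : X →L[ℝ] X) : X →ₗ[ℝ] X).IsSymmetric := by
  intro x y
  have := hD.isSymmetric (S.symm x) (S.symm y)
  simpa using this.symm

theorem IsAccretiveSystem.eq_zero_of_inner_symm_nonpos (hD : IsAccretiveSystem D S B) {x : X}
    (hx : inner ℝ (S.symm x) x ≤ 0) : x = 0 := by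
  have h : S.symm x = 0 := hD.eq_zero_of_inner_nonpos (by
    rwa [S.apply_symm_apply, real_inner_comm])
  simpa using h

theorem hasWeakDeriv_inner_of_orthogonal (hp : IntegrableOn p (Icc 0 T))
    (h : ∀ G q r z, IsClassicalSolution D T G q r z →
      inner ℝ (q 0) P₀ + ∫ t in Icc 0 T, inner ℝ (G t) (p t) = 0)
    {w v : X} {z : Z} (hw : (w, v, z) ∈ D) :
    HasWeakDeriv T (fun t => inner ℝ w (p t)) (fun t => inner ℝ v (p t)) (inner ℝ w P₀) 0 := by
  intro φ hφ
  have key := h _ _ _ _ (isClassicalSolution_separated hw hφ)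
  have hint : ∀ {ψ : ℝ → ℝ} (x : X), Continuous ψ →
      Integrable (fun t => ψ t * inner ℝ x (p t)) (volume.restrict (Icc 0 T)) := fun x hψ =>
    IntegrableOn.continuousOn_mul hψ.continuousOn (hp.const_inner x) isCompact_Icc
  simp only [inner_add_left, real_inner_smul_left] at key
  rw [integral_add (hint w (hφ.continuous_deriv (by simp))) (hint v hφ.continuous)] at key
  simp only [mul_comm _ (deriv φ _), mul_comm _ (φ _)]
  linarith

variable [CompleteSpace X]

theorem intervalIntegral_inner_const (w : X) {t : ℝ} (hp : IntegrableOn p (Icc 0 T))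
    (ht : t ∈ Icc 0 T) :
    ∫ τ in t..T, inner ℝ w (p τ) = inner ℝ w (∫ τ in t..T, p τ) := by
  refine (innerSL ℝ w).intervalIntegral_comp_comm ?_
  rw [intervalIntegrable_iff_integrableOn_Ioc_of_le ht.2]
  exact hp.mono_set (Ioc_subset_Icc_self.trans (Icc_subset_Icc_left ht.1))

theorem inner_primitive_of_orthogonal (hT : 0 ≤ T) (hp : IntegrableOn p (Icc 0 T))
    (h : ∀ G q r z, IsClassicalSolution D T G q r z →
      inner ℝ (q 0) P₀ + ∫ t in Icc 0 T, inner ℝ (G t) (p t) = 0)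
    {w v : X} {z : Z} (hw : (w, v, z) ∈ D) :
    inner ℝ w P₀ = -inner ℝ v (∫ τ in (0 : ℝ)..T, p τ) ∧
      ∀ t ∈ Icc 0 T, inner ℝ w (∫ τ in t..T, p τ) =
        -inner ℝ v (∫ τ in t..T, ∫ σ in τ..T, p σ) := by
  have hweak := hasWeakDeriv_inner_of_orthogonal hp h hw
  have h0 : inner ℝ w P₀ = -inner ℝ v (∫ τ in (0 : ℝ)..T, p τ) := by
    have := hweak.boundary_eq hT
    rw [intervalIntegral_inner_const v hp (left_mem_Icc.2 hT)] at this
    linarith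
  have hi : ∀ x, IntegrableOn (fun t => inner ℝ x (p t)) (Icc 0 T) := fun x =>
    Integrable.const_inner x hp
  have hae : ∀ᵐ t ∂(volume.restrict (Icc 0 T)), inner ℝ w (p t) =
      inner ℝ (-v) (∫ τ in t..T, p τ) := by
    filter_upwards [hweak.ae_eq_primitive hT (hi w) (hi v),
      ae_restrict_mem measurableSet_Icc] with t ht htm
    have := integral_to_right_eq_sub (hi v) htm
    rw [intervalIntegral_inner_const v hp htm,
      intervalIntegral_inner_const v hp (left_mem_Icc.2 hT)] at this
    rw [ht, h0, inner_neg_left]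
    linarith
  refine ⟨h0, fun t ht => ?_⟩
  have hP : IntegrableOn (fun t => ∫ τ in t..T, p τ) (Icc 0 T) :=
    (continuousOn_integral_to_right hp).integrableOn_Icc
  have hv : IntegrableOn (fun t => inner ℝ (-v) (∫ τ in t..T, p τ)) (Icc 0 T) :=
    Integrable.const_inner (-v) hP
  rw [← intervalIntegral_inner_const w hp ht, ← inner_neg_left,
    ← intervalIntegral_inner_const (-v) hP ht, integral_to_right_eq_sub (hi w) ht,
    integral_to_right_eq_sub hv ht, intervalIntegral_congr_Icc ht hae,
    intervalIntegral_congr_Icc (right_mem_Icc.2 hT) hae]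

-- The second primitive of `p`, with time reversed, solves the homogeneous adjoint problem.
theorem eq_zero_of_orthogonal (hD : IsAccretiveSystem D S B) (hT : 0 < T)
    (hp : IntegrableOn p (Icc 0 T))
    (h : ∀ G q r z, IsClassicalSolution D T G q r z →
      inner ℝ (q 0) P₀ + ∫ t in Icc 0 T, inner ℝ (G t) (p t) = 0) :
    P₀ = 0 ∧ ∀ᵐ t ∂(volume.restrict (Icc 0 T)), p t = 0 := by
  have hmem : ∀ t ∈ Icc 0 T, T - t ∈ Icc 0 T := fun t ht =>
    ⟨by linarith [ht.2], by linarith [ht.1]⟩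
  have hrev : EqOn (fun t => ∫ τ in (T - t)..T, p τ) 0 (Icc 0 T) := by
    refine eqOn_zero_of_inner_primitive_nonpos hD.isSymmetric_symm
      (fun x hx => hD.eq_zero_of_inner_symm_nonpos hx) hT
      ((continuousOn_integral_to_right hp).comp (by fun_prop) hmem) fun t ht =>
      hD.adjoint_accretive _ _ fun w v z hw => ?_
    rw [intervalIntegral.integral_comp_sub_left (fun s => ∫ τ in s..T, p τ), sub_zero,
      real_inner_comm,
      (inner_primitive_of_orthogonal hT.le hp h hw).2 _ (hmem t ht), real_inner_comm]
  have hP : ∀ t ∈ Icc 0 T, ∫ τ in t..T, p τ = 0 := by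
    intro t ht
    simpa using hrev (hmem t ht)
  have h0 := hP 0 (left_mem_Icc.2 hT.le)
  refine ⟨hD.dense_domain _ fun w v z hw => ?_, ae_eq_zero_of_primitive_eq_zero hp fun t ht => ?_⟩
  · rw [real_inner_comm, (inner_primitive_of_orthogonal hT.le hp h hw).1, h0,
      inner_zero_right, neg_zero]
  · have := integral_to_right_eq_sub hp ht
    rwa [hP t ht, h0, zero_sub, zero_eq_neg] at this

end Density

section ClassicalGraph

variable (X Z : Type*) [NormedAddCommGroup X] [InnerProductSpace ℝ X] [NormedAddCommGroup Z]
  [NormedSpace ℝ Z] (T : ℝ)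

/-- The Hilbert space of pairs of an initial value and a forcing on `[0, T]`. -/
abbrev Data : Type _ := WithLp 2 (X × Lp X 2 (volume.restrict (Icc 0 T)))

/-- Pairs of a continuous function of time with values in `X`, of which only the restriction to
`[0, T]` matters, and of boundary values which are square integrable on `[0, T]`. -/
abbrev Trajectory : Type _ :=
  BoundedContinuousFunction ℝ X × Lp Z 2 (volume.restrict (Icc 0 T))

variable {X Z T}

/-- The graph of the map taking the initial value and the forcing of a classical solution to that
solution and its boundary values. Solutions are extended from `[0, T]` to `ℝ` by constants. -/
def classicalGraph (D : Submodule ℝ (X × X × Z)) (T : ℝ) :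
    Submodule ℝ (Data X T × Trajectory X Z T) where
  carrier := {p | ∃ G q r z, IsClassicalSolution D T G q r z ∧ p.1.fst = q 0 ∧
    p.1.snd =ᵐ[volume.restrict (Icc 0 T)] G ∧ (∀ t, p.2.1 t = q (max 0 (min T t))) ∧
    p.2.2 =ᵐ[volume.restrict (Icc 0 T)] z}
  add_mem' := by
    rintro p p' ⟨G, q, r, z, h, h0, hG, hq, hz⟩ ⟨G', q', r', z', h', h0', hG', hq', hz'⟩
    refine ⟨_, _, _, _, h.add h', ?_, ?_, fun t => ?_, ?_⟩
    · simp [h0, h0']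
    · exact (Lp.coeFn_add _ _).trans (hG.add hG')
    · simp [hq, hq']
    · exact (Lp.coeFn_add _ _).trans (hz.add hz')
  zero_mem' := ⟨_, _, _, _, .zero, rfl, Lp.coeFn_zero _ _ _, fun _ => rfl, Lp.coeFn_zero _ _ _⟩
  smul_mem' := by
    rintro c p ⟨G, q, r, z, h, h0, hG, hq, hz⟩
    refine ⟨_, _, _, _, h.smul c, ?_, ?_, fun t => ?_, ?_⟩
    · simp [h0]
    · exact (Lp.coeFn_smul _ _).trans (hG.const_smul c)
    · simp [hq]
    · exact (Lp.coeFn_smul _ _).trans (hz.const_smul c)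

variable {D : Submodule ℝ (X × X × Z)} {S : X ≃L[ℝ] X} {B : Z →L[ℝ] Z →L[ℝ] ℝ}
  {G q r : ℝ → X} {z : ℝ → Z}

theorem IsClassicalSolution.exists_mem_classicalGraph (h : IsClassicalSolution D T G q r z) :
    ∃ p ∈ classicalGraph D T, p.1.fst = q 0 ∧ p.1.snd =ᵐ[volume.restrict (Icc 0 T)] G := by
  have hG := memLp_of_continuousOn 2 h.continuous_forcing.continuousOn (a := 0) (b := T)
  have hz := memLp_of_continuousOn 2 h.continuous_trace.continuousOn (a := 0) (b := T)
  obtain ⟨C, hC⟩ := (isCompact_Icc (a := min 0 T) (b := max 0 T)).exists_bound_of_continuousOn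
    h.continuous.continuousOn
  let y : BoundedContinuousFunction ℝ X := .ofNormedAddCommGroup
    (fun t => q (max 0 (min T t))) (h.continuous.comp (by fun_prop)) C fun t => hC _
      ⟨(min_le_left _ _).trans (le_max_left _ _), max_le_max_left 0 (min_le_left T t)⟩
  exact ⟨(WithLp.toLp 2 (q 0, hG.toLp G), (y, hz.toLp z)),
    ⟨G, q, r, z, h, rfl, hG.coeFn_toLp, fun _ => rfl, hz.coeFn_toLp⟩, rfl, hG.coeFn_toLp⟩

theorem exists_graph_bound (hD : IsAccretiveSystem D S B) (hT : 0 ≤ T) :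
    ∃ C : NNReal, ∀ p ∈ classicalGraph D T, ‖p.2‖ ≤ C * ‖p.1‖ := by
  obtain ⟨K, hK0, hK⟩ := exists_forall_norm_le hD
  obtain ⟨K', hK0', hK'⟩ := exists_integral_norm_trace_sq_le hD hT
  refine ⟨⟨max K K' * (1 + √T), by positivity⟩, ?_⟩
  rintro p ⟨G, q, r, z, h, h0, hG, hq, hz⟩
  have hdata : ‖q 0‖ + ∫ τ in (0 : ℝ)..T, ‖G τ‖ ≤ (1 + √T) * ‖p.1‖ := by
    rw [← h0, ← integral_Icc_eq hT, ← integral_congr_ae (hG.mono fun τ hτ => congrArg norm hτ)]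
    exact norm_fst_add_integral_norm_snd_le hT p.1
  have hdata0 : 0 ≤ ‖q 0‖ + ∫ τ in (0 : ℝ)..T, ‖G τ‖ := add_nonneg (norm_nonneg _)
    (intervalIntegral.integral_nonneg hT fun τ _ => norm_nonneg _)
  have hmul : ∀ k ≤ max K K', k * (‖q 0‖ + ∫ τ in (0 : ℝ)..T, ‖G τ‖) ≤
      max K K' * (1 + √T) * ‖p.1‖ := fun k hk => by
    rw [mul_assoc]
    exact mul_le_mul hk hdata hdata0 (hK0.trans (le_max_left _ _))
  refine norm_prod_le_iff.2 ⟨(BoundedContinuousFunction.norm_le ?_).2 fun t => ?_, ?_⟩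
  · exact (mul_nonneg hK0 hdata0).trans (hmul K (le_max_left _ _))
  · rw [hq]
    exact (hK hT h _ ⟨le_max_left _ _, max_le hT (min_le_left _ _)⟩).trans
      (hmul K (le_max_left _ _))
  · refine le_trans ?_ (hmul K' (le_max_right _ _))
    refine abs_le_of_sq_le_sq' ?_ (mul_nonneg hK0' hdata0) |>.2
    rw [norm_Lp_two_sq, integral_congr_ae (hz.mono fun τ hτ => congrArg (‖·‖ ^ 2) hτ),
      integral_Icc_eq hT]
    exact hK' h

theorem dense_image_fst_classicalGraph [CompleteSpace X] (hD : IsAccretiveSystem D S B)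
    (hT : 0 < T) :
    Dense (Prod.fst '' (classicalGraph D T : Set (Data X T × Trajectory X Z T))) := by
  let Γ := (classicalGraph D T).map (LinearMap.fst ℝ (Data X T) (Trajectory X Z T))
  change Dense (Γ : Set (Data X T))
  rw [Submodule.dense_iff_topologicalClosure_eq_top, Submodule.topologicalClosure_eq_top_iff,
    Submodule.eq_bot_iff]
  intro d hd
  have hint : IntegrableOn d.snd (Icc 0 T) := (Lp.memLp d.snd).integrable (by norm_num)
  obtain ⟨h1, h2⟩ := eq_zero_of_orthogonal hD hT hint (P₀ := d.fst) fun G q r z h => by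
    obtain ⟨p, hp, hp0, hpG⟩ := h.exists_mem_classicalGraph
    have key := hd p.1 ⟨p, hp, rfl⟩
    rw [WithLp.prod_inner_apply, L2.inner_def] at key
    rw [← hp0, ← integral_congr_ae (hpG.mono fun τ hτ => congrArg (inner ℝ · (d.snd τ)) hτ)]
    exact key
  refine (WithLp.ofLp_injective 2) (Prod.ext h1 ?_)
  exact Lp.eq_zero_iff_ae_eq_zero.2 h2

end ClassicalGraph

section ContinuityOfIntegrals

variable {E F G : Type*} [NormedAddCommGroup E] [NormedSpace ℝ E] [NormedAddCommGroup F]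
  [NormedSpace ℝ F] [NormedAddCommGroup G] [NormedSpace ℝ G] {T t : ℝ}

theorem continuous_intervalIntegral_bilin (B : E →L[ℝ] F →L[ℝ] G) (ht : t ∈ Icc 0 T) :
    Continuous fun p : Lp E 2 (volume.restrict (Icc 0 T)) × Lp F 2 (volume.restrict (Icc 0 T)) =>
      ∫ τ in (0 : ℝ)..t, B (p.1 τ) (p.2 τ) := by
  simp only [intervalIntegral_eq_setIntegral_restrict ht]
  exact continuous_setIntegral_bilin B _

theorem continuous_intervalIntegral_Lp (ht : t ∈ Icc 0 T) :
    Continuous fun g : Lp E 2 (volume.restrict (Icc 0 T)) => ∫ τ in (0 : ℝ)..t, g τ := by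
  simp only [intervalIntegral_eq_setIntegral_restrict ht]
  exact continuous_setIntegral_Lp _

theorem intervalIntegral_toLp (ht : t ∈ Icc 0 T) (y : BoundedContinuousFunction ℝ E)
    (f : ℝ → E → F) :
    ∫ τ in (0 : ℝ)..t, f τ (y.toLp 2 (volume.restrict (Icc 0 T)) ℝ τ) =
      ∫ τ in (0 : ℝ)..t, f τ (y τ) :=
  intervalIntegral_congr_Icc ht ((y.coeFn_toLp 2 _ ℝ).mono fun τ hτ => congrArg (f τ) hτ)

theorem continuous_intervalIntegral_boundedContinuousFunction (ht : t ∈ Icc 0 T) :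
    Continuous fun y : BoundedContinuousFunction ℝ E => ∫ τ in (0 : ℝ)..t, y τ :=
  ((continuous_intervalIntegral_Lp ht).comp
    (BoundedContinuousFunction.toLp 2 (volume.restrict (Icc 0 T)) ℝ).continuous).congr
    fun y => intervalIntegral_toLp ht y fun _ x => x

theorem continuous_intervalIntegral_inner {X : Type*} [NormedAddCommGroup X]
    [InnerProductSpace ℝ X] (A : X →L[ℝ] X) (ht : t ∈ Icc 0 T) :
    Continuous fun p : Lp X 2 (volume.restrict (Icc 0 T)) × BoundedContinuousFunction ℝ X =>
      ∫ τ in (0 : ℝ)..t, inner ℝ (A (p.1 τ)) (p.2 τ) :=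
  ((continuous_intervalIntegral_bilin ((innerSL ℝ (E := X)).comp A) ht).comp
    (continuous_id.prodMap
      (BoundedContinuousFunction.toLp 2 (volume.restrict (Icc 0 T)) ℝ).continuous)).congr
    fun p => intervalIntegral_toLp ht p.2 fun τ x => inner ℝ (A (p.1 τ)) x

end ContinuityOfIntegrals

section MildSolution

variable {X Z : Type*} [NormedAddCommGroup X] [InnerProductSpace ℝ X] [NormedAddCommGroup Z]
  [NormedSpace ℝ Z] {D : Submodule ℝ (X × X × Z)} {S : X ≃L[ℝ] X}
  {B : Z →L[ℝ] Z →L[ℝ] ℝ} {T t : ℝ}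

theorem initial_of_mem_closure_classicalGraph (hT : 0 ≤ T) {p : Data X T × Trajectory X Z T}
    (hp : p ∈ closure (classicalGraph D T : Set (Data X T × Trajectory X Z T))) :
    p.2.1 0 = p.1.fst := by
  have hy : Continuous fun p : Data X T × Trajectory X Z T => p.2.1 0 :=
    (BoundedContinuousFunction.evalCLM ℝ (β := X) (0 : ℝ)).continuous.comp (by fun_prop)
  have h0 : Continuous fun p : Data X T × Trajectory X Z T => p.1.fst :=
    (WithLp.continuous_fst 2 X _).comp (by fun_prop)
  refine closure_minimal (t := {p : Data X T × Trajectory X Z T | p.2.1 0 = p.1.fst}) ?_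
    (isClosed_eq hy h0) hp
  rintro p ⟨G, q, r, z, -, h0, -, hq, -⟩
  rw [mem_ofPred_eq, h0, hq, min_eq_right hT, max_self]

theorem integral_mem_of_mem_closure_classicalGraph [CompleteSpace X] [CompleteSpace Z]
    (hD : IsClosed (D : Set (X × X × Z))) (ht : t ∈ Icc 0 T) {p : Data X T × Trajectory X Z T}
    (hp : p ∈ closure (classicalGraph D T : Set (Data X T × Trajectory X Z T))) :
    (∫ τ in (0 : ℝ)..t, p.2.1 τ, p.1.fst - p.2.1 t + ∫ τ in (0 : ℝ)..t, p.1.snd τ,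
      ∫ τ in (0 : ℝ)..t, p.2.2 τ) ∈ D := by
  have hint := continuous_intervalIntegral_boundedContinuousFunction (E := X) ht
  have hy : Continuous fun y : BoundedContinuousFunction ℝ X => y t :=
    (BoundedContinuousFunction.evalCLM ℝ (β := X) t).continuous
  have h0 := WithLp.continuous_fst 2 X (Lp X 2 (volume.restrict (Icc 0 T)))
  have hG := (continuous_intervalIntegral_Lp (E := X) ht).comp
    (WithLp.continuous_snd 2 X (Lp X 2 (volume.restrict (Icc 0 T))))
  have hz := continuous_intervalIntegral_Lp (E := Z) ht
  have hc := (hint.comp (continuous_fst.comp continuous_snd)).prodMk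
    ((((h0.comp continuous_fst).sub (hy.comp (continuous_fst.comp continuous_snd))).add
      (hG.comp continuous_fst)).prodMk (hz.comp (continuous_snd.comp continuous_snd)))
  refine closure_minimal ?_ (hD.preimage hc) hp
  rintro p ⟨G, q, r, z, h, h0, hG, hq, hz⟩
  have hclamp : ∀ τ ∈ Icc 0 T, p.2.1 τ = q τ := fun τ hτ => by
    rw [hq, min_eq_right hτ.2, max_eq_right hτ.1]
  have key := h.integral_mem hD ht
  rw [← h0, ← hclamp t ht, ← intervalIntegral_congr_Icc ht hG, ← intervalIntegral_congr_Icc ht hz,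
    ← intervalIntegral_congr_Icc ht ((ae_restrict_mem measurableSet_Icc).mono hclamp)] at key
  exact key

theorem integral_two_mul_inner_sub_two_mul_bilin (ht : t ∈ Icc 0 T) {G q : ℝ → X} {z : ℝ → Z}
    (hG : MemLp G 2 (volume.restrict (Icc 0 T))) (hq : MemLp q 2 (volume.restrict (Icc 0 T)))
    (hz : MemLp z 2 (volume.restrict (Icc 0 T))) :
    ∫ τ in (0 : ℝ)..t, (2 * inner ℝ (S (G τ)) (q τ) - 2 * B (z τ) (z τ)) =
      2 * (∫ τ in (0 : ℝ)..t, inner ℝ (S (G τ)) (q τ)) -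
        2 * ∫ τ in (0 : ℝ)..t, B (z τ) (z τ) := by
  have hA : IntegrableOn (fun τ => inner ℝ (S (G τ)) (q τ)) (Icc 0 T) := memLp_one_iff_integrable.1
    (((innerSL ℝ (E := X)).comp (S : X →L[ℝ] X)).memLp_of_bilin 1 hG hq)
  have hB : IntegrableOn (fun τ => B (z τ) (z τ)) (Icc 0 T) :=
    memLp_one_iff_integrable.1 (B.memLp_of_bilin 1 hz hz)
  rw [intervalIntegral.integral_sub ((intervalIntegrable_of_Icc ht hA).const_mul 2)
    ((intervalIntegrable_of_Icc ht hB).const_mul 2), intervalIntegral.integral_const_mul,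
    intervalIntegral.integral_const_mul]

theorem energy_eq_of_mem_closure_classicalGraph (hD : IsAccretiveSystem D S B) (ht : t ∈ Icc 0 T)
    {p : Data X T × Trajectory X Z T}
    (hp : p ∈ closure (classicalGraph D T : Set (Data X T × Trajectory X Z T))) :
    inner ℝ (S (p.2.1 t)) (p.2.1 t) - inner ℝ (S (p.2.1 0)) (p.2.1 0) =
      2 * (∫ τ in (0 : ℝ)..t, inner ℝ (S (p.1.snd τ)) (p.2.1 τ)) -
        2 * ∫ τ in (0 : ℝ)..t, B (p.2.2 τ) (p.2.2 τ) := by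
  have hy : ∀ s, Continuous fun p : Data X T × Trajectory X Z T => p.2.1 s := fun s =>
    (BoundedContinuousFunction.evalCLM ℝ (β := X) s).continuous.comp (by fun_prop)
  have hA := (continuous_intervalIntegral_inner (S : X →L[ℝ] X) ht).comp
    (((WithLp.continuous_snd 2 X (Lp X 2 (volume.restrict (Icc 0 T)))).comp continuous_fst).prodMk
      (continuous_fst.comp continuous_snd : Continuous fun p : Data X T × Trajectory X Z T =>
        p.2.1))
  have hB := (continuous_intervalIntegral_bilin B ht).comp
    ((continuous_snd.comp continuous_snd).prodMk (continuous_snd.comp continuous_snd) :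
      Continuous fun p : Data X T × Trajectory X Z T => (p.2.2, p.2.2))
  refine closure_minimal ?_ (isClosed_eq
    (((S.continuous.comp (hy t)).inner (hy t)).sub ((S.continuous.comp (hy 0)).inner (hy 0)))
    ((hA.const_mul 2).sub (hB.const_mul 2))) hp
  rintro p ⟨G, q, r, z, h, -, hG, hq, hz⟩
  have hclamp : ∀ τ ∈ Icc 0 T, p.2.1 τ = q τ := fun τ hτ => by
    rw [hq, min_eq_right hτ.2, max_eq_right hτ.1]
  have hGq : ∫ τ in (0 : ℝ)..t, inner ℝ (S (p.1.snd τ)) (p.2.1 τ) =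
      ∫ τ in (0 : ℝ)..t, inner ℝ (S (G τ)) (q τ) := intervalIntegral_congr_Icc ht (by
    filter_upwards [hG, ae_restrict_mem measurableSet_Icc] with τ hGτ hτ
    rw [hGτ, hclamp τ hτ])
  have hzz : ∫ τ in (0 : ℝ)..t, B (p.2.2 τ) (p.2.2 τ) = ∫ τ in (0 : ℝ)..t, B (z τ) (z τ) :=
    intervalIntegral_congr_Icc ht (hz.mono fun τ hτ => by rw [hτ])
  have key := h.energy_eq hD ht
  rw [integral_two_mul_inner_sub_two_mul_bilin ht
    (memLp_of_continuousOn 2 h.continuous_forcing.continuousOn)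
    (memLp_of_continuousOn 2 h.continuous.continuousOn)
    (memLp_of_continuousOn 2 h.continuous_trace.continuousOn), ← hGq, ← hzz, ← hclamp t ht,
    ← hclamp 0 ⟨le_rfl, ht.1.trans ht.2⟩] at key
  exact key

theorem exists_isMildSolution [CompleteSpace X] [CompleteSpace Z] (hD : IsAccretiveSystem D S B)
    (hT : 0 < T) (f : X) {G : ℝ → X} (hG : MemLp G 2 (volume.restrict (Icc 0 T))) :
    ∃ q z, IsMildSolution D T f G q z ∧ ∀ t ∈ Icc 0 T,
      inner ℝ (S (q t)) (q t) - inner ℝ (S f) f =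
        ∫ τ in (0 : ℝ)..t, (2 * inner ℝ (S (G τ)) (q τ) - 2 * B (z τ) (z τ)) := by
  obtain ⟨C, hC⟩ := exists_graph_bound hD hT.le
  obtain ⟨⟨y, ζ⟩, hmem⟩ := exists_mem_closure_of_dense_image_fst hC
    (dense_image_fst_classicalGraph hD hT) (WithLp.toLp 2 (f, hG.toLp G))
  have h0 : y 0 = f := initial_of_mem_closure_classicalGraph hT.le hmem
  refine ⟨y, ζ, ⟨y.continuous.continuousOn, h0, Lp.memLp ζ, fun t ht => ?_⟩, fun t ht => ?_⟩
  · have := integral_mem_of_mem_closure_classicalGraph hD.isClosed ht hmem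
    change (_, f - y t + ∫ τ in (0 : ℝ)..t, hG.toLp G τ, _) ∈ D at this
    rwa [intervalIntegral_congr_Icc ht hG.coeFn_toLp] at this
  · have := energy_eq_of_mem_closure_classicalGraph hD ht hmem
    have hGy : ∫ τ in (0 : ℝ)..t, inner ℝ (S (hG.toLp G τ)) (y τ) =
        ∫ τ in (0 : ℝ)..t, inner ℝ (S (G τ)) (y τ) :=
      intervalIntegral_congr_Icc ht (hG.coeFn_toLp.mono fun τ hτ => by rw [hτ])
    rw [integral_two_mul_inner_sub_two_mul_bilin ht hG
      (memLp_of_continuousOn 2 y.continuous.continuousOn) (Lp.memLp ζ), ← hGy, ← h0]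
    exact this

theorem IsMildSolution.unique [CompleteSpace X] [CompleteSpace Z] (hD : IsAccretiveSystem D S B)
    (hT : 0 < T) {f : X} {G q q' : ℝ → X} {z z' : ℝ → Z} (h : IsMildSolution D T f G q z)
    (h' : IsMildSolution D T f G q' z') :
    EqOn q q' (Icc 0 T) ∧ z =ᵐ[volume.restrict (Icc 0 T)] z' := by
  have hdiff : ∀ t ∈ Icc 0 T, (∫ τ in (0 : ℝ)..t, (q τ - q' τ), -(q t - q' t),
      ∫ τ in (0 : ℝ)..t, (z τ - z' τ)) ∈ D := by
    intro t ht
    have hq := fun {p : ℝ → X} (hp : ContinuousOn p (Icc 0 T)) =>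
      intervalIntegrable_of_Icc ht hp.integrableOn_Icc
    have hz := fun {p : ℝ → Z} (hp : MemLp p 2 (volume.restrict (Icc 0 T))) =>
      intervalIntegrable_of_Icc ht (hp.integrable (by norm_num))
    rw [intervalIntegral.integral_sub (hq h.continuousOn) (hq h'.continuousOn),
      intervalIntegral.integral_sub (hz h.memLp_trace) (hz h'.memLp_trace)]
    have := D.sub_mem (h.mem t ht) (h'.mem t ht)
    rwa [Prod.mk_sub_mk, Prod.mk_sub_mk, add_sub_add_right_eq_sub, sub_sub_sub_cancel_left,
      ← neg_sub (q t)] at this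
  have hq : EqOn (fun t => q t - q' t) 0 (Icc 0 T) := by
    refine eqOn_zero_of_inner_primitive_nonpos hD.isSymmetric
      (fun x hx => hD.eq_zero_of_inner_nonpos hx) hT (h.continuousOn.sub h'.continuousOn)
      fun t ht => ?_
    have := hD.green _ _ _ (hdiff t ht)
    rw [map_neg, inner_neg_left] at this
    have := hD.form_nonneg _ _ _ (hdiff t ht)
    rw [ContinuousLinearEquiv.coe_coe]
    linarith
  refine ⟨fun t ht => sub_eq_zero.1 (hq ht), ?_⟩
  obtain ⟨N, C, -, htrace⟩ := hD.trace_bound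
  have hzero : ∀ t ∈ Icc 0 T, ∫ τ in (0 : ℝ)..t, (z τ - z' τ) = 0 := by
    intro t ht
    have := htrace _ _ _ (hdiff t ht)
    rw [intervalIntegral_congr_Icc ht ((ae_restrict_mem measurableSet_Icc).mono hq)] at this
    simpa using this
  refine (ae_eq_zero_of_primitive_eq_zero ((h.memLp_trace.sub h'.memLp_trace).integrable
    (by norm_num)) hzero).mono fun t ht => sub_eq_zero.1 ht

theorem IsMildSolution.energy_eq [CompleteSpace X] [CompleteSpace Z] {f : X} {G q : ℝ → X}
    {z : ℝ → Z} (h : IsMildSolution D T f G q z) (hD : IsAccretiveSystem D S B) (hT : 0 < T)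
    (hG : MemLp G 2 (volume.restrict (Icc 0 T))) (ht : t ∈ Icc 0 T) :
    inner ℝ (S (q t)) (q t) - inner ℝ (S f) f =
      ∫ τ in (0 : ℝ)..t, (2 * inner ℝ (S (G τ)) (q τ) - 2 * B (z τ) (z τ)) := by
  obtain ⟨q', z', h', henergy⟩ := exists_isMildSolution hD hT f hG
  obtain ⟨hq, hz⟩ := h.unique hD hT h'
  rw [hq ht, henergy t ht]
  refine intervalIntegral_congr_Icc ht ?_
  filter_upwards [hz, ae_restrict_mem measurableSet_Icc] with τ hzτ hτ
  rw [hq hτ, hzτ]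

end MildSolution

section StateSpace

variable {L : ℝ}

theorem integrable_apply (q : State L) (i : Fin 2) :
    Integrable (fun x => q x i) (volume.restrict (Icc (0 : ℝ) L)) :=
  ((EuclideanSpace.proj (𝕜 := ℝ) i).comp_memLp' (Lp.memLp q)).integrable (by norm_num)

theorem inner_eq_integral_dotProduct (p q : State L) :
    inner ℝ p q = ∫ x in Icc (0 : ℝ) L, (p x).ofLp ⬝ᵥ (q x).ofLp := by
  rw [L2.inner_def]
  refine integral_congr_ae (.of_forall fun x => ?_)
  simp [PiLp.inner_apply, dotProduct, mul_comm]

theorem integrable_dotProduct (p q : State L) :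
    Integrable (fun x => (p x).ofLp ⬝ᵥ (q x).ofLp) (volume.restrict (Icc (0 : ℝ) L)) := by
  refine (L2.integrable_inner (𝕜 := ℝ) p q).congr (.of_forall fun x => ?_)
  simp [PiLp.inner_apply, dotProduct, mul_comm]

/-- The state given by a pair of continuous functions on `[0, L]`. -/
def ofContinuousOn (F : ℝ → Fin 2 → ℝ) (hF : ContinuousOn F (Icc 0 L)) : State L :=
  (memLp_of_continuousOn 2 ((PiLp.continuous_toLp 2 _).comp_continuousOn hF)).toLp
    (fun x => WithLp.toLp 2 (F x))

theorem coeFn_ofContinuousOn {F : ℝ → Fin 2 → ℝ} (hF : ContinuousOn F (Icc 0 L)) :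
    ∀ᵐ x ∂(volume.restrict (Icc (0 : ℝ) L)), (ofContinuousOn F hF x).ofLp = F x :=
  (MemLp.coeFn_toLp _).mono fun _ hx => congrArg WithLp.ofLp hx

variable {A A' : ℝ → Matrix (Fin 2) (Fin 2) ℝ}

theorem memLp_toEuclideanCLM (hA : ContinuousOn A (Icc 0 L)) :
    MemLp (fun x => Matrix.toEuclideanCLM (𝕜 := ℝ) (n := Fin 2) (A x)) ⊤
      (volume.restrict (Icc (0 : ℝ) L)) :=
  memLp_of_continuousOn ⊤ ((LinearMap.continuous_of_finiteDimensional
    (Matrix.toEuclideanCLM (𝕜 := ℝ) (n := Fin 2)).toAlgEquiv.toLinearMap).comp_continuousOn hA)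

/-- Multiplication of a state by a continuous matrix function, as a bounded operator. -/
def mulVecOp (A : ℝ → Matrix (Fin 2) (Fin 2) ℝ) (hA : ContinuousOn A (Icc 0 L)) :
    State L →L[ℝ] State L :=
  (ContinuousLinearMap.id ℝ (EuclideanSpace ℝ (Fin 2) →L[ℝ] EuclideanSpace ℝ (Fin 2))).holderL
    (volume.restrict (Icc (0 : ℝ) L)) ⊤ 2 2 ((memLp_toEuclideanCLM hA).toLp _)

theorem coeFn_mulVecOp (hA : ContinuousOn A (Icc 0 L)) (q : State L) :
    ∀ᵐ x ∂(volume.restrict (Icc (0 : ℝ) L)), (mulVecOp A hA q x).ofLp = A x *ᵥ (q x).ofLp := by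
  simp only [mulVecOp, ContinuousLinearMap.holderL_apply_apply]
  filter_upwards [ContinuousLinearMap.coeFn_holder (p := ⊤) (q := 2) (r := 2)
      (ContinuousLinearMap.id ℝ (EuclideanSpace ℝ (Fin 2) →L[ℝ] EuclideanSpace ℝ (Fin 2)))
      ((memLp_toEuclideanCLM hA).toLp _) q,
    MemLp.coeFn_toLp (memLp_toEuclideanCLM hA)] with x h1 h2
  rw [h1, h2]
  simp

theorem inner_mulVecOp (hA : ContinuousOn A (Icc 0 L)) (p q : State L) :
    inner ℝ p (mulVecOp A hA q) =
      ∫ x in Icc (0 : ℝ) L, (p x).ofLp ⬝ᵥ (A x *ᵥ (q x).ofLp) := by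
  rw [inner_eq_integral_dotProduct]
  refine integral_congr_ae ?_
  filter_upwards [coeFn_mulVecOp hA q] with x hx
  rw [hx]

theorem integrable_dotProduct_mulVec (hA : ContinuousOn A (Icc 0 L)) (p q : State L) :
    Integrable (fun x => (p x).ofLp ⬝ᵥ (A x *ᵥ (q x).ofLp)) (volume.restrict (Icc (0 : ℝ) L)) :=
  (integrable_dotProduct p (mulVecOp A hA q)).congr
    ((coeFn_mulVecOp hA q).mono fun x hx => by simp only [hx])

theorem isSymmetric_mulVecOp (hA : ContinuousOn A (Icc 0 L)) (h : ∀ x, (A x).IsSymm) :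
    ((mulVecOp A hA : State L →L[ℝ] State L) : State L →ₗ[ℝ] State L).IsSymmetric := by
  intro p q
  rw [ContinuousLinearMap.coe_coe, real_inner_comm, inner_mulVecOp, inner_mulVecOp]
  congr 1 with x
  rw [dotProduct_comm, Matrix.dotProduct_mulVec, ← Matrix.mulVec_transpose, h x]

theorem mulVecOp_mulVecOp_cancel (hA : ContinuousOn A (Icc 0 L)) (hA' : ContinuousOn A' (Icc 0 L))
    (h : ∀ x ∈ Icc 0 L, A x * A' x = 1) (q : State L) :
    mulVecOp A hA (mulVecOp A' hA' q) = q := by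
  apply Lp.ext
  filter_upwards [coeFn_mulVecOp hA (mulVecOp A' hA' q), coeFn_mulVecOp hA' q,
    ae_restrict_mem measurableSet_Icc] with x h1 h2 hx
  rw [h2, Matrix.mulVec_mulVec, h x hx, Matrix.one_mulVec] at h1
  exact WithLp.ofLp_injective 2 h1

theorem mul_norm_sq_le_inner_mulVecOp_self (hA : ContinuousOn A (Icc 0 L)) {c : ℝ}
    (h : ∀ x ∈ Icc 0 L, ∀ y : Fin 2 → ℝ, c * (y ⬝ᵥ y) ≤ y ⬝ᵥ (A x *ᵥ y)) (q : State L) :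
    c * ‖q‖ ^ 2 ≤ inner ℝ q (mulVecOp A hA q) := by
  rw [← real_inner_self_eq_norm_sq, inner_eq_integral_dotProduct, inner_mulVecOp,
    ← integral_const_mul]
  exact setIntegral_mono_on ((integrable_dotProduct q q).const_mul c)
    (integrable_dotProduct_mulVec hA q q) measurableSet_Icc fun x hx => h x hx _

theorem continuousOn_matrix_two {X : Type*} [TopologicalSpace X] {s : Set X} {a b c d : X → ℝ}
    (ha : ContinuousOn a s) (hb : ContinuousOn b s) (hc : ContinuousOn c s)
    (hd : ContinuousOn d s) : ContinuousOn (fun x => !![a x, b x; c x, d x]) s := by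
  refine continuousOn_pi.2 fun i => continuousOn_pi.2 fun j => ?_
  fin_cases i <;> fin_cases j <;> simpa

theorem continuousOn_matrix_inv {X n : Type*} [TopologicalSpace X] [Fintype n]
    [DecidableEq n] {s : Set X} {A : X → Matrix n n ℝ} (hA : ContinuousOn A s)
    (h : ∀ x ∈ s, IsUnit (A x).det) : ContinuousOn (fun x => (A x)⁻¹) s := by
  simp only [Matrix.inv_def, Ring.inverse_eq_inv']
  exact ((continuous_id.matrix_det.comp_continuousOn hA).inv₀ fun x hx => (h x hx).ne_zero).smul
    (continuous_id.matrix_adjugate.comp_continuousOn hA)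

end StateSpace

section Subcritical

/-- A background flow with continuous velocity, continuously differentiable positive depth, and
positive `g H - U ^ 2`. -/
structure IsSubcritical (g L : ℝ) (U H : ℝ → ℝ) : Prop where
  g_pos : 0 < g
  L_pos : 0 < L
  continuousOn_U : ContinuousOn U (Icc 0 L)
  contDiffOn_H : ContDiffOn ℝ 1 H (Icc 0 L)
  H_pos : ∀ x ∈ Icc 0 L, 0 < H x
  det_pos : ∀ x ∈ Icc 0 L, 0 < g * H x - U x ^ 2

variable {g L : ℝ} {U H : ℝ → ℝ}

theorem isSubcritical_of_froude_lt_one (hg : 0 < g) (hL : 0 < L)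
    (hU : ContinuousOn U (Icc 0 L)) (hH : ContDiffOn ℝ 1 H (Icc 0 L))
    (hHpos : ∀ x ∈ Icc 0 L, 0 < H x) (hFr : ∀ x ∈ Icc 0 L, |U x| / √(g * H x) < 1) :
    IsSubcritical g L U H where
  g_pos := hg
  L_pos := hL
  continuousOn_U := hU
  contDiffOn_H := hH
  H_pos := hHpos
  det_pos x hx := by
    have h := hFr x hx
    rw [div_lt_one (Real.sqrt_pos.2 (mul_pos hg (hHpos x hx))), Real.lt_sqrt (abs_nonneg _),
      sq_abs] at h
    exact sub_pos.2 h

-- The matrices `M` and `W` differ by an exchange of rows.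
theorem flux_apply (q : State L) (x : ℝ) (i : Fin 2) :
    flux g U H q x i = (weightMatrix g U H x *ᵥ (q x).ofLp) i.rev := by
  fin_cases i <;> simp [flux, fluxMatrix, weightMatrix, Matrix.mulVec, Fin.rev]

theorem wInner_eq_integral_flux (p q : State L) :
    wInner g U H p q =
      ∫ x in Icc (0 : ℝ) L, (p x 0 * flux g U H q x 1 + p x 1 * flux g U H q x 0) := by
  simp only [wInner, dotProduct, Fin.sum_univ_two, flux_apply]
  rfl

theorem isSymm_weightMatrix (x : ℝ) : (weightMatrix g U H x).IsSymm :=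
  Matrix.IsSymm.ext fun i j => by fin_cases i <;> fin_cases j <;> rfl

theorem det_weightMatrix (x : ℝ) : (weightMatrix g U H x).det = g * H x - U x ^ 2 := by
  rw [weightMatrix, Matrix.det_fin_two_of, sq]

namespace IsSubcritical

variable (hs : IsSubcritical g L U H)
include hs

theorem continuousOn_H : ContinuousOn H (Icc 0 L) :=
  hs.contDiffOn_H.continuousOn

theorem continuousOn_fluxMatrix : ContinuousOn (fluxMatrix g U H) (Icc 0 L) :=
  continuousOn_matrix_two hs.continuousOn_U hs.continuousOn_H continuousOn_const hs.continuousOn_U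

theorem continuousOn_weightMatrix : ContinuousOn (weightMatrix g U H) (Icc 0 L) :=
  continuousOn_matrix_two continuousOn_const hs.continuousOn_U hs.continuousOn_U hs.continuousOn_H

theorem isUnit_det_weightMatrix {x : ℝ} (hx : x ∈ Icc 0 L) :
    IsUnit (weightMatrix g U H x).det :=
  (det_weightMatrix x).symm ▸ (hs.det_pos x hx).ne'.isUnit

theorem continuousOn_inv_weightMatrix :
    ContinuousOn (fun x => (weightMatrix g U H x)⁻¹) (Icc 0 L) :=
  continuousOn_matrix_inv hs.continuousOn_weightMatrix fun _ => hs.isUnit_det_weightMatrix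

/-- Multiplication of a state by the flux matrix `M`. -/
def fluxOp : State L →L[ℝ] State L :=
  mulVecOp (fluxMatrix g U H) hs.continuousOn_fluxMatrix

/-- Multiplication of a state by the weight matrix `W`, as an invertible operator. -/
def weightOp : State L ≃L[ℝ] State L :=
  .equivOfInverse (mulVecOp (weightMatrix g U H) hs.continuousOn_weightMatrix)
    (mulVecOp (fun x => (weightMatrix g U H x)⁻¹) hs.continuousOn_inv_weightMatrix)
    (mulVecOp_mulVecOp_cancel _ _ fun _ hx =>
      Matrix.nonsing_inv_mul _ (hs.isUnit_det_weightMatrix hx))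
    (mulVecOp_mulVecOp_cancel _ _ fun _ hx =>
      Matrix.mul_nonsing_inv _ (hs.isUnit_det_weightMatrix hx))

theorem coeFn_fluxOp (q : State L) :
    ∀ᵐ x ∂(volume.restrict (Icc (0 : ℝ) L)), ∀ i, hs.fluxOp q x i = flux g U H q x i :=
  (coeFn_mulVecOp hs.continuousOn_fluxMatrix q).mono fun _ hx => congrFun hx

theorem integrable_flux (q : State L) (i : Fin 2) :
    Integrable (fun x => flux g U H q x i) (volume.restrict (Icc (0 : ℝ) L)) :=
  (integrable_apply (hs.fluxOp q) i).congr ((hs.coeFn_fluxOp q).mono fun _ hx => hx i)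

theorem flux_weightOp_symm (q : State L) :
    ∀ᵐ x ∂(volume.restrict (Icc (0 : ℝ) L)), ∀ i,
      flux g U H (hs.weightOp.symm q) x i = q x i.rev := by
  filter_upwards [coeFn_mulVecOp hs.continuousOn_weightMatrix (hs.weightOp.symm q)] with x hx i
  rw [flux_apply, ← hx]
  exact congrArg (fun p : State L => p x i.rev) (hs.weightOp.apply_symm_apply q)

theorem isSymmetric_weightOp :
    ((hs.weightOp : State L →L[ℝ] State L) : State L →ₗ[ℝ] State L).IsSymmetric :=
  isSymmetric_mulVecOp hs.continuousOn_weightMatrix isSymm_weightMatrix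

theorem inner_weightOp (p q : State L) : inner ℝ (hs.weightOp p) q = wInner g U H p q := by
  rw [← ContinuousLinearEquiv.coe_coe]
  exact (hs.isSymmetric_weightOp p q).trans (inner_mulVecOp hs.continuousOn_weightMatrix p q)

-- For a symmetric positive definite `W` the smallest eigenvalue is at least `det W / tr W`.
theorem mul_dotProduct_le_weightMatrix {x c : ℝ} (hx : x ∈ Icc 0 L)
    (hc : c ≤ (g * H x - U x ^ 2) / (g + H x)) (y : Fin 2 → ℝ) :
    c * (y ⬝ᵥ y) ≤ y ⬝ᵥ (weightMatrix g U H x *ᵥ y) := by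
  have htr := add_pos hs.g_pos (hs.H_pos x hx)
  rw [le_div_iff₀ htr] at hc
  simp only [weightMatrix, dotProduct, Matrix.mulVec, Fin.sum_univ_two, Matrix.of_apply,
    Matrix.cons_val', Matrix.cons_val_zero, Matrix.cons_val_one, Matrix.cons_val_fin_one]
  rw [← sub_nonneg]
  refine nonneg_of_mul_nonneg_right (a := g + H x) ?_ htr
  nlinarith [sq_nonneg (g * y 0 + U x * y 1), sq_nonneg (U x * y 0 + H x * y 1),
    mul_nonneg (sub_nonneg.2 hc) (add_nonneg (sq_nonneg (y 0)) (sq_nonneg (y 1)))]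

theorem exists_mul_norm_sq_le_wInner : ∃ c > 0, ∀ q : State L, c * ‖q‖ ^ 2 ≤ wInner g U H q q := by
  have hpos : ∀ x ∈ Icc 0 L, 0 < (g * H x - U x ^ 2) / (g + H x) := fun x hx =>
    div_pos (hs.det_pos x hx) (add_pos hs.g_pos (hs.H_pos x hx))
  have hcont : ContinuousOn (fun x => (g * H x - U x ^ 2) / (g + H x)) (Icc 0 L) :=
    ((continuousOn_const.mul hs.continuousOn_H).sub (hs.continuousOn_U.pow 2)).div
      (continuousOn_const.add hs.continuousOn_H)
      fun x hx => (add_pos hs.g_pos (hs.H_pos x hx)).ne'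
  obtain ⟨x₀, hx₀, hmin⟩ :=
    isCompact_Icc.exists_isMinOn (nonempty_Icc.2 hs.L_pos.le) hcont
  refine ⟨_, hpos x₀ hx₀, fun q => ?_⟩
  rw [← hs.inner_weightOp, real_inner_comm]
  exact mul_norm_sq_le_inner_mulVecOp_self hs.continuousOn_weightMatrix
    (fun x hx => hs.mul_dotProduct_le_weightMatrix hx (hmin hx)) q

theorem wInner_nonneg (q : State L) : 0 ≤ wInner g U H q q := by
  obtain ⟨c, hc, h⟩ := hs.exists_mul_norm_sq_le_wInner
  exact (by positivity : 0 ≤ c * ‖q‖ ^ 2).trans (h q)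

theorem wNorm_sq (q : State L) : wNorm g U H q ^ 2 = wInner g U H q q :=
  Real.sq_sqrt (hs.wInner_nonneg q)

theorem wNorm_pos {q : State L} (hq : q ≠ 0) : 0 < wNorm g U H q := by
  obtain ⟨c, hc, h⟩ := hs.exists_mul_norm_sq_le_wInner
  exact Real.sqrt_pos.2 ((by positivity : 0 < c * ‖q‖ ^ 2).trans_le (h q))

theorem wInner_le (p q : State L) : wInner g U H p q ≤ wNorm g U H p * wNorm g U H q := by
  have h := LinearMap.BilinForm.apply_sq_le_of_symm
    ((innerₗ (State L)).comp (hs.weightOp : State L →ₗ[ℝ] State L))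
    (fun q => (hs.wInner_nonneg q).trans_eq (hs.inner_weightOp q q).symm)
    ⟨fun p q => (hs.isSymmetric_weightOp p q).trans (real_inner_comm _ _)⟩ p q
  change inner ℝ (hs.weightOp p) q ^ 2 ≤
    inner ℝ (hs.weightOp p) p * inner ℝ (hs.weightOp q) q at h
  rw [hs.inner_weightOp, hs.inner_weightOp, hs.inner_weightOp, ← hs.wNorm_sq, ← hs.wNorm_sq,
    ← mul_pow] at h
  exact le_of_sq_le_sq h (mul_nonneg (Real.sqrt_nonneg _) (Real.sqrt_nonneg _))

end IsSubcritical

end Subcritical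

section BoundaryValues

/-- Boundary values of the flux: its values at `0` and at `L`. -/
abbrev Traces : Type := (Fin 2 → ℝ) × (Fin 2 → ℝ)

/-- The component `i` of the boundary values at `0`, as a bounded functional. -/
def traceZero (i : Fin 2) : Traces →L[ℝ] ℝ :=
  (ContinuousLinearMap.proj i).comp (ContinuousLinearMap.fst ℝ _ _)

/-- The component `i` of the boundary values at `L`, as a bounded functional. -/
def traceL (i : Fin 2) : Traces →L[ℝ] ℝ :=
  (ContinuousLinearMap.proj i).comp (ContinuousLinearMap.snd ℝ _ _)

/-- The functional whose vanishing is the boundary condition at `0`. -/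
def bcZero (α₁ α₂ : ℝ) : Traces →L[ℝ] ℝ := α₁ • traceZero 0 + α₂ • traceZero 1

/-- The functional whose vanishing is the boundary condition at `L`. -/
def bcL (β₁ β₂ : ℝ) : Traces →L[ℝ] ℝ := β₁ • traceL 0 - β₂ • traceL 1

/-- The bilinear form `F₁ F₂ |_L - F₁ F₂ |₀` of the boundary values, the negative of the boundary
term `BT`. -/
def boundaryForm : Traces →L[ℝ] Traces →L[ℝ] ℝ :=
  (ContinuousLinearMap.mul ℝ ℝ).bilinearComp (traceL 0) (traceL 1) -
    (ContinuousLinearMap.mul ℝ ℝ).bilinearComp (traceZero 0) (traceZero 1)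

theorem boundaryForm_apply (z : Traces) :
    boundaryForm z z = z.2 0 * z.2 1 - z.1 0 * z.1 1 :=
  rfl

theorem norm_sq_le_of_traces (z : Traces) :
    ‖z‖ ^ 2 ≤ z.1 0 ^ 2 + z.1 1 ^ 2 + z.2 0 ^ 2 + z.2 1 ^ 2 := by
  have hpi : ∀ y : Fin 2 → ℝ, ‖y‖ ^ 2 ≤ y 0 ^ 2 + y 1 ^ 2 := fun y => by
    refine (Real.le_sqrt (norm_nonneg y) (by positivity)).1 ?_
    refine (pi_norm_le_iff_of_nonneg (Real.sqrt_nonneg _)).2 (Fin.forall_fin_two.2 ⟨?_, ?_⟩)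
    · exact Real.abs_le_sqrt (le_add_of_nonneg_right (sq_nonneg _))
    · exact Real.abs_le_sqrt (le_add_of_nonneg_left (sq_nonneg _))
  rcases max_choice ‖z.1‖ ‖z.2‖ with h | h
  · rw [Prod.norm_def, h]
    linarith [hpi z.1, sq_nonneg (z.2 0), sq_nonneg (z.2 1)]
  · rw [Prod.norm_def, h]
    linarith [hpi z.2, sq_nonneg (z.1 0), sq_nonneg (z.1 1)]

/-- The coefficients of the boundary conditions are dissipative: both pairs are nonnegative and
nonzero. -/
structure IsDissipative (α₁ α₂ β₁ β₂ : ℝ) : Prop where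
  α₁_nonneg : 0 ≤ α₁
  α₂_nonneg : 0 ≤ α₂
  β₁_nonneg : 0 ≤ β₁
  β₂_nonneg : 0 ≤ β₂
  α_ne : (α₁, α₂) ≠ (0, 0)
  β_ne : (β₁, β₂) ≠ (0, 0)

theorem mul_nonpos_of_add_eq_zero {α₁ α₂ x y : ℝ} (h₁ : 0 ≤ α₁) (h₂ : 0 ≤ α₂)
    (hα : (α₁, α₂) ≠ (0, 0)) (h : α₁ * x + α₂ * y = 0) : x * y ≤ 0 := by
  have hpos : 0 < α₁ + α₂ := by
    refine (add_nonneg h₁ h₂).lt_of_ne' fun h0 => hα ?_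
    rw [(add_eq_zero_iff_of_nonneg h₁ h₂).1 h0 |>.1, (add_eq_zero_iff_of_nonneg h₁ h₂).1 h0 |>.2]
  refine nonpos_of_mul_nonpos_right ?_ hpos
  calc (α₁ + α₂) * (x * y) = -(α₁ * x ^ 2 + α₂ * y ^ 2) := by linear_combination (x + y) * h
    _ ≤ 0 := neg_nonpos.2 (by positivity)

theorem IsDissipative.boundaryTerm_nonpos {α₁ α₂ β₁ β₂ : ℝ} (hd : IsDissipative α₁ α₂ β₁ β₂)
    {a b : Fin 2 → ℝ} (ha : α₁ * a 0 + α₂ * a 1 = 0) (hb : β₁ * b 0 - β₂ * b 1 = 0) :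
    a 0 * a 1 - b 0 * b 1 ≤ 0 := by
  have h1 := mul_nonpos_of_add_eq_zero hd.α₁_nonneg hd.α₂_nonneg hd.α_ne ha
  have h2 : b 0 * -b 1 ≤ 0 := mul_nonpos_of_add_eq_zero hd.β₁_nonneg hd.β₂_nonneg hd.β_ne
    (by linear_combination hb)
  linarith

end BoundaryValues

section FluxGraph

variable {g L : ℝ} {U H : ℝ → ℝ} {α₁ α₂ β₁ β₂ : ℝ}

/-- The state `φ • y` for a continuous function `φ` and a constant vector `y`. -/
def smulState {φ : ℝ → ℝ} (hφ : Continuous φ) (y : Fin 2 → ℝ) : State L :=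
  ofContinuousOn (fun x => φ x • y) (hφ.smul continuous_const).continuousOn

theorem coeFn_smulState {φ : ℝ → ℝ} (hφ : Continuous φ) (y : Fin 2 → ℝ) :
    ∀ᵐ x ∂(volume.restrict (Icc (0 : ℝ) L)), (smulState hφ y : State L) x = φ x • y :=
  coeFn_ofContinuousOn _

theorem inner_smulState {φ : ℝ → ℝ} (hφ : Continuous φ) (y : Fin 2 → ℝ) (q : State L) :
    inner ℝ q (smulState hφ y) =
      y 0 * (∫ x in Icc 0 L, q x 0 * φ x) + y 1 * ∫ x in Icc 0 L, q x 1 * φ x := by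
  rw [inner_eq_integral_dotProduct, ← integral_const_mul, ← integral_const_mul, ← integral_add]
  · refine integral_congr_ae ((coeFn_smulState hφ y).mono fun x hx => ?_)
    simp only [hx, dotProduct, Fin.sum_univ_two, Pi.smul_apply, smul_eq_mul]
    ring
  all_goals
    exact (IntegrableOn.mul_continuousOn (integrable_apply q _) hφ.continuousOn
      isCompact_Icc).const_mul _

/-- Integration of the component `i` of a state against `φ`, as a bounded functional. -/
def testPairing {φ : ℝ → ℝ} (hφ : Continuous φ) (i : Fin 2) : State L →L[ℝ] ℝ :=
  innerSL ℝ (smulState hφ (Pi.single i 1))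

theorem testPairing_apply {φ : ℝ → ℝ} (hφ : Continuous φ) (i : Fin 2) (q : State L) :
    testPairing hφ i q = ∫ x in Icc 0 L, q x i * φ x := by
  rw [testPairing, innerSL_apply_apply, real_inner_comm, inner_smulState]
  fin_cases i <;> simp

/-- The projection of a triple `(w, v, z)` to its boundary values `z`. -/
def traces : State L × State L × Traces →L[ℝ] Traces :=
  (ContinuousLinearMap.snd ℝ _ _).comp (ContinuousLinearMap.snd ℝ _ _)

namespace IsSubcritical

variable (hs : IsSubcritical g L U H)
include hs

/-- The left-hand side of the weak formulation of `∂(M w)/∂x = v` with boundary values `z`, tested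
with `φ` in the component `i`. -/
def balance {φ : ℝ → ℝ} (hφ : ContDiff ℝ ∞ φ) (i : Fin 2) :
    State L × State L × Traces →L[ℝ] ℝ :=
  ((testPairing (hφ.continuous_deriv (by simp)) i).comp hs.fluxOp).coprod
    ((testPairing hφ.continuous i).coprod (φ 0 • traceZero i - φ L • traceL i))

theorem balance_apply {φ : ℝ → ℝ} (hφ : ContDiff ℝ ∞ φ) (i : Fin 2) (w v : State L) (z : Traces) :
    hs.balance hφ i (w, v, z) = (∫ x in Icc 0 L, flux g U H w x i * deriv φ x) +
      (∫ x in Icc 0 L, v x i * φ x) + z.1 i * φ 0 - z.2 i * φ L := by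
  have hflux : ∫ x in Icc 0 L, hs.fluxOp w x i * deriv φ x =
      ∫ x in Icc 0 L, flux g U H w x i * deriv φ x :=
    integral_congr_ae ((hs.coeFn_fluxOp w).mono fun x hx => by simp only [hx])
  simp only [balance, traceZero, traceL, ContinuousLinearMap.coprod_apply,
    ContinuousLinearMap.comp_apply, sub_apply, smul_apply,
    ContinuousLinearMap.coe_fst', ContinuousLinearMap.coe_snd', ContinuousLinearMap.proj_apply,
    smul_eq_mul, testPairing_apply, hflux]
  ring

/-- The graph of the spatial operator: the triples `(w, v, z)` such that `∂(M w)/∂x = v`, and such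
that `z` are the boundary values of `M w` and satisfy the boundary conditions. -/
def fluxGraph (α₁ α₂ β₁ β₂ : ℝ) : Submodule ℝ (State L × State L × Traces) :=
  (⨅ (φ : ℝ → ℝ) (hφ : ContDiff ℝ ∞ φ) (i : Fin 2), (hs.balance hφ i).ker) ⊓
    ((bcZero α₁ α₂).comp traces).ker ⊓ ((bcL β₁ β₂).comp traces).ker

theorem isClosed_fluxGraph :
    IsClosed (hs.fluxGraph α₁ α₂ β₁ β₂ : Set (State L × State L × Traces)) := by
  simp only [fluxGraph, Submodule.coe_inf, Submodule.coe_iInf]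
  exact ((isClosed_iInter fun _ => isClosed_iInter fun _ => isClosed_iInter fun _ =>
    ContinuousLinearMap.isClosed_ker _).inter (ContinuousLinearMap.isClosed_ker _)).inter
      (ContinuousLinearMap.isClosed_ker _)

theorem mem_fluxGraph {w v : State L} {z : Traces} :
    (w, v, z) ∈ hs.fluxGraph α₁ α₂ β₁ β₂ ↔
      (∀ i, HasWeakDeriv L (fun x => flux g U H w x i) (fun x => v x i) (z.1 i) (z.2 i)) ∧
        α₁ * z.1 0 + α₂ * z.1 1 = 0 ∧ β₁ * z.2 0 - β₂ * z.2 1 = 0 := by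
  simp only [fluxGraph, Submodule.mem_inf, Submodule.mem_iInf, and_assoc]
  refine and_congr ⟨fun h i φ hφ => ?_, fun h φ hφ i => ?_⟩ Iff.rfl
  · exact (hs.balance_apply hφ i w v z).symm.trans (h φ hφ i)
  · exact (hs.balance_apply hφ i w v z).trans (h i φ hφ)

theorem inner_weightOp_of_mem_fluxGraph {w v : State L} {z : Traces}
    (h : (w, v, z) ∈ hs.fluxGraph α₁ α₂ β₁ β₂) :
    inner ℝ (hs.weightOp v) w = boundaryForm z z := by
  have hflux := (hs.mem_fluxGraph.1 h).1
  rw [hs.inner_weightOp, wInner_eq_integral_flux, boundaryForm_apply,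
    ← (hflux 0).integral_mul_add_mul hs.L_pos.le (hs.integrable_flux w 0) (integrable_apply v 0)
      (hs.integrable_flux w 1) (integrable_apply v 1) (hflux 1)]
  simp only [mul_comm (flux g U H w _ 0)]

theorem mem_fluxGraph_of_contDiff {φ : ℝ → ℝ} (hφ : ContDiff ℝ ∞ φ) {y : Fin 2 → ℝ}
    (h0 : φ 0 * (α₁ * y 0 + α₂ * y 1) = 0) (hL : φ L * (β₁ * y 0 - β₂ * y 1) = 0) :
    (hs.weightOp.symm (smulState hφ.continuous (y ∘ Fin.rev)),
      smulState (hφ.continuous_deriv (by simp)) y, (φ 0 • y, φ L • y)) ∈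
        hs.fluxGraph α₁ α₂ β₁ β₂ := by
  refine hs.mem_fluxGraph.2 ⟨fun i => ?_, ?_, ?_⟩
  · refine ((hasWeakDeriv_of_contDiff hs.L_pos.le hφ).mul_const (y i)).congr_ae ?_ ?_
    · filter_upwards [hs.flux_weightOp_symm (smulState hφ.continuous (y ∘ Fin.rev)),
        coeFn_smulState hφ.continuous (y ∘ Fin.rev)] with x hflux hx
      rw [hflux, hx, Pi.smul_apply, Function.comp_apply, Fin.rev_rev, smul_eq_mul]
    · filter_upwards [coeFn_smulState (hφ.continuous_deriv (by simp)) y] with x hx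
      rw [hx, Pi.smul_apply, smul_eq_mul]
  · simp only [Pi.smul_apply, smul_eq_mul]
    linear_combination h0
  · simp only [Pi.smul_apply, smul_eq_mul]
    linear_combination hL

end IsSubcritical

end FluxGraph

section Adjoint

namespace IsSubcritical

variable {g L : ℝ} {U H : ℝ → ℝ} {α₁ α₂ β₁ β₂ : ℝ} (hs : IsSubcritical g L U H)
include hs

theorem sum_mul_integral_eq_zero {P Q : State L}
    (hPQ : ∀ w v z, (w, v, z) ∈ hs.fluxGraph α₁ α₂ β₁ β₂ → inner ℝ P w = -inner ℝ Q v)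
    {φ : ℝ → ℝ} (hφ : ContDiff ℝ ∞ φ) {y : Fin 2 → ℝ}
    (h0 : φ 0 * (α₁ * y 0 + α₂ * y 1) = 0) (hL : φ L * (β₁ * y 0 - β₂ * y 1) = 0) :
    ∑ i, y i * ((∫ x in Icc 0 L, Q x i * deriv φ x) +
      ∫ x in Icc 0 L, hs.weightOp.symm P x i.rev * φ x) = 0 := by
  have hmem := hPQ _ _ _ (hs.mem_fluxGraph_of_contDiff hφ h0 hL)
  have hsymm : ∀ p, inner ℝ P (hs.weightOp.symm p) = inner ℝ (hs.weightOp.symm P) p := fun p => by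
    simpa using hs.isSymmetric_weightOp (hs.weightOp.symm P) (hs.weightOp.symm p)
  rw [hsymm, inner_smulState, inner_smulState] at hmem
  have hrev : Fin.rev (0 : Fin 2) = 1 ∧ Fin.rev (1 : Fin 2) = 0 := ⟨rfl, rfl⟩
  simp only [Function.comp_apply, Fin.sum_univ_two, hrev] at hmem ⊢
  linear_combination hmem

theorem exists_hasWeakDeriv_of_orthogonal {P Q : State L}
    (hPQ : ∀ w v z, (w, v, z) ∈ hs.fluxGraph α₁ α₂ β₁ β₂ → inner ℝ P w = -inner ℝ Q v) :
    ∃ c d : Fin 2 → ℝ, (∀ i, HasWeakDeriv L (fun x => Q x i)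
        (fun x => hs.weightOp.symm P x i.rev) (c i) (d i)) ∧
      α₂ * c 0 - α₁ * c 1 = 0 ∧ β₂ * d 0 + β₁ * d 1 = 0 := by
  have hex : ∀ i : Fin 2, ∃ c d : ℝ, HasWeakDeriv L (fun x => Q x i)
      (fun x => hs.weightOp.symm P x i.rev) c d := fun i => by
    refine exists_hasWeakDeriv hs.L_pos (integrable_apply Q i) (integrable_apply _ _)
      fun φ hφ h0 hL => ?_
    have hsum := hs.sum_mul_integral_eq_zero hPQ hφ (y := Pi.single i 1)
      (by rw [h0, zero_mul]) (by rw [hL, zero_mul])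
    simpa [Pi.single_apply] using hsum
  choose c d hcd using hex
  have hboundary : ∀ {φ : ℝ → ℝ}, ContDiff ℝ ∞ φ → ∀ {y : Fin 2 → ℝ},
      φ 0 * (α₁ * y 0 + α₂ * y 1) = 0 → φ L * (β₁ * y 0 - β₂ * y 1) = 0 →
      ∑ i, y i * (d i * φ L - c i * φ 0) = 0 := fun {φ} hφ {y} h0 hL => by
    refine (Finset.sum_congr rfl fun i _ => ?_).trans (hs.sum_mul_integral_eq_zero hPQ hφ h0 hL)
    linear_combination -y i * hcd i φ hφ
  have hc := hboundary (φ := fun x => 1 - x / L) (by fun_prop) (y := ![α₂, -α₁])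
    (by simp only [Matrix.cons_val_zero, Matrix.cons_val_one]; ring)
    (by simp only [div_self hs.L_pos.ne', sub_self, zero_mul])
  have hd := hboundary (φ := fun x => x / L) (by fun_prop) (y := ![β₂, β₁])
    (by simp only [zero_div, zero_mul])
    (by simp only [Matrix.cons_val_zero, Matrix.cons_val_one]; ring)
  simp only [Fin.sum_univ_two, Matrix.cons_val_zero, Matrix.cons_val_one, zero_div,
    div_self hs.L_pos.ne'] at hc hd
  exact ⟨c, d, hcd, by linear_combination -hc, by linear_combination hd⟩

theorem inner_weightOp_symm_nonpos (hd : IsDissipative α₁ α₂ β₁ β₂) {P Q : State L}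
    (hPQ : ∀ w v z, (w, v, z) ∈ hs.fluxGraph α₁ α₂ β₁ β₂ → inner ℝ P w = -inner ℝ Q v) :
    inner ℝ (hs.weightOp.symm P) Q ≤ 0 := by
  obtain ⟨c, d, hcd, hc, hd'⟩ := hs.exists_hasWeakDeriv_of_orthogonal hPQ
  have hinner : inner ℝ (hs.weightOp.symm P) Q = d 0 * d 1 - c 0 * c 1 := by
    rw [inner_eq_integral_dotProduct, ← (hcd 0).integral_mul_add_mul hs.L_pos.le
      (integrable_apply Q 0) (integrable_apply _ _) (integrable_apply Q 1) (integrable_apply _ _)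
      (hcd 1)]
    simp [dotProduct, Fin.sum_univ_two, mul_comm, add_comm]
  have h0 : -c 1 * c 0 ≤ 0 := mul_nonpos_of_add_eq_zero hd.α₁_nonneg hd.α₂_nonneg hd.α_ne
    (by linear_combination hc)
  have hL : d 1 * d 0 ≤ 0 := mul_nonpos_of_add_eq_zero hd.β₁_nonneg hd.β₂_nonneg hd.β_ne
    (by linear_combination hd')
  linarith

theorem eq_zero_of_orthogonal_domain {P : State L}
    (hP : ∀ w v z, (w, v, z) ∈ hs.fluxGraph α₁ α₂ β₁ β₂ → inner ℝ P w = 0) : P = 0 := by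
  obtain ⟨c, d, hcd, -⟩ := hs.exists_hasWeakDeriv_of_orthogonal (Q := 0) fun w v z h => by
    rw [hP w v z h, inner_zero_left, neg_zero]
  have hzero : ∀ i, ∀ᵐ x ∂(volume.restrict (Icc 0 L)), (0 : State L) x i = 0 := fun i =>
    (Lp.coeFn_zero _ 2 _).mono fun x hx => by
      rw [hx]
      rfl
  have hcomp : ∀ i : Fin 2, ∀ᵐ x ∂(volume.restrict (Icc 0 L)), hs.weightOp.symm P x i.rev = 0 :=
    fun i => (hcd i).ae_eq_zero_of_ae_eq_zero (integrable_apply _ _) (hzero i)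
  refine hs.weightOp.symm.map_eq_zero_iff.1 (Lp.eq_zero_iff_ae_eq_zero.2 ?_)
  filter_upwards [hcomp 0, hcomp 1] with x h0 h1
  ext i
  fin_cases i
  exacts [h1, h0]

end IsSubcritical

end Adjoint

section TraceBound

variable {L : ℝ}

theorem integrable_weight_mul_apply {c : ℝ → ℝ} (hc : ContinuousOn c (Icc 0 L)) (p q : State L)
    (i : Fin 2) : Integrable (fun x => c x * (p x i * q x i)) (volume.restrict (Icc (0 : ℝ) L)) :=
  have hmemLp (p : State L) := (EuclideanSpace.proj (𝕜 := ℝ) i).comp_memLp' (Lp.memLp p)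
  IntegrableOn.continuousOn_mul hc ((hmemLp p).integrable_mul (hmemLp q)) isCompact_Icc

theorem inner_mulVecOp_diagonal {c : ℝ → Fin 2 → ℝ} (hc : ContinuousOn c (Icc 0 L))
    (p q : State L) :
    inner ℝ p (mulVecOp (fun x => Matrix.diagonal (c x)) (by fun_prop) q) =
      ∑ i, ∫ x in Icc 0 L, c x i * (p x i * q x i) := by
  rw [inner_mulVecOp, ← integral_finsetSum _ fun i _ =>
    integrable_weight_mul_apply (continuousOn_pi.1 hc i) p q i]
  congr 1 with x
  simp only [dotProduct, Matrix.mulVec_diagonal, mul_left_comm]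

/-- The diagonal of the weight `(2 x / L - 1) diag(g, H)`, which is negative at `0` and positive at
`L`, so that it bounds the boundary values at both ends. -/
def traceWeight (g L : ℝ) (H : ℝ → ℝ) (x : ℝ) : Fin 2 → ℝ := (2 * x / L - 1) • ![g, H x]

/-- The derivative of `traceWeight` on `[0, L]`. -/
def traceWeightDeriv (g L : ℝ) (H : ℝ → ℝ) (x : ℝ) : Fin 2 → ℝ :=
  (2 / L) • ![g, H x] + (2 * x / L - 1) • ![0, derivWithin H (Icc 0 L) x]

namespace IsSubcritical

variable {g : ℝ} {U H : ℝ → ℝ} {α₁ α₂ β₁ β₂ : ℝ} (hs : IsSubcritical g L U H)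
include hs

theorem continuousOn_traceWeight : ContinuousOn (traceWeight g L H) (Icc 0 L) := by
  have hH := hs.continuousOn_H
  refine continuousOn_pi.2 (Fin.forall_fin_two.2 ⟨?_, ?_⟩) <;>
    simp only [traceWeight, Pi.smul_apply, Matrix.cons_val_zero, Matrix.cons_val_one] <;> fun_prop

theorem continuousOn_traceWeightDeriv : ContinuousOn (traceWeightDeriv g L H) (Icc 0 L) := by
  have hH := hs.continuousOn_H
  have hH' := hs.contDiffOn_H.continuousOn_derivWithin (uniqueDiffOn_Icc hs.L_pos) le_rfl
  refine continuousOn_pi.2 (Fin.forall_fin_two.2 ⟨?_, ?_⟩) <;>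
    simp only [traceWeightDeriv, Pi.add_apply, Pi.smul_apply, Matrix.cons_val_zero,
      Matrix.cons_val_one] <;> fun_prop

theorem hasDerivAt_traceWeight {x : ℝ} (hx : x ∈ Ioo 0 L) :
    HasDerivAt (traceWeight g L H) (traceWeightDeriv g L H x) x := by
  have hH : HasDerivAt H (derivWithin H (Icc 0 L) x) x :=
    (hs.contDiffOn_H.differentiableOn one_ne_zero x
      (Ioo_subset_Icc_self hx)).hasDerivWithinAt.hasDerivAt (Icc_mem_nhds hx.1 hx.2)
  have hgH : HasDerivAt (fun x => ![g, H x]) ![0, derivWithin H (Icc 0 L) x] x :=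
    hasDerivAt_pi.2 (Fin.forall_fin_two.2 ⟨hasDerivAt_const x g, hH⟩)
  have hm : HasDerivAt (fun x => 2 * x / L - 1) (2 / L) x := by
    simpa using (((hasDerivAt_id x).const_mul 2).div_const L).sub_const 1
  rw [traceWeightDeriv, add_comm]
  exact hm.smul hgH

theorem traceWeight_eq_add_integral (i : Fin 2) {x : ℝ} (hx : x ∈ Icc 0 L) :
    traceWeight g L H x i =
      traceWeight g L H 0 i + ∫ y in (0 : ℝ)..x, traceWeightDeriv g L H y i := by
  rw [intervalIntegral.integral_eq_sub_of_hasDerivAt_of_le hx.1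
    ((continuousOn_pi.1 hs.continuousOn_traceWeight i).mono (Icc_subset_Icc_right hx.2))
    (fun y hy => hasDerivAt_pi.1 (hs.hasDerivAt_traceWeight ⟨hy.1, hy.2.trans_le hx.2⟩) i)
    (intervalIntegrable_of_Icc hx
      (continuousOn_pi.1 hs.continuousOn_traceWeightDeriv i).integrableOn_Icc), add_sub_cancel]

/-- Multiplication of a state by the diagonal matrix with the derivative of the trace weight: the
lower order term in the bound for the boundary values. -/
def traceRemainder : State L →L[ℝ] State L :=
  mulVecOp (fun x => Matrix.diagonal (traceWeightDeriv g L H x))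
    (by
      have := hs.continuousOn_traceWeightDeriv
      fun_prop)

/-- Multiplication of a state by the symmetric matrix `(2 x / L - 1) diag(g, H) M`, the multiplier
that bounds the boundary values of a solution. -/
def traceMultiplier : State L →L[ℝ] State L :=
  mulVecOp (fun x => Matrix.diagonal (traceWeight g L H x) * fluxMatrix g U H x)
    (by
      have h1 := hs.continuousOn_traceWeight
      have h2 := hs.continuousOn_fluxMatrix
      fun_prop)

theorem isSymmetric_traceMultiplier :
    (hs.traceMultiplier : State L →ₗ[ℝ] State L).IsSymmetric := by
  refine isSymmetric_mulVecOp _ fun x => ?_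
  ext i j
  fin_cases i <;> fin_cases j <;> simp [traceWeight, fluxMatrix, mul_assoc, mul_comm g]

theorem inner_traceMultiplier (p q : State L) : inner ℝ (hs.traceMultiplier p) q =
    ∑ i, ∫ x in Icc 0 L, traceWeight g L H x i * (p x i * hs.fluxOp q x i) := by
  rw [← inner_mulVecOp_diagonal hs.continuousOn_traceWeight, inner_mulVecOp]
  refine (hs.isSymmetric_traceMultiplier p q).trans ((inner_mulVecOp _ p q).trans ?_)
  refine integral_congr_ae ((coeFn_mulVecOp hs.continuousOn_fluxMatrix q).mono fun x hx => ?_)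
  simp only [fluxOp, hx, Matrix.mulVec_mulVec]

theorem traces_eq_of_mem_fluxGraph {w v : State L} {z : Traces}
    (h : (w, v, z) ∈ hs.fluxGraph α₁ α₂ β₁ β₂) :
    g * (z.1 0 ^ 2 + z.2 0 ^ 2) + H 0 * z.1 1 ^ 2 + H L * z.2 1 ^ 2 =
      2 * inner ℝ (hs.traceMultiplier v) w +
        inner ℝ (hs.fluxOp w) (hs.traceRemainder (hs.fluxOp w)) := by
  have hflux (i : Fin 2) : HasWeakDeriv L (fun x => hs.fluxOp w x i) (fun x => v x i) (z.1 i)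
      (z.2 i) :=
    ((hs.mem_fluxGraph.1 h).1 i).congr_ae ((hs.coeFn_fluxOp w).mono fun x hx => hx i)
      (.of_forall fun _ => rfl)
  have hsq (i : Fin 2) := (hflux i).integral_weight_mul_sq hs.L_pos.le (integrable_apply _ i)
    (integrable_apply v i) (fun x hx => hs.traceWeight_eq_add_integral i hx)
    (continuousOn_pi.1 hs.continuousOn_traceWeightDeriv i).integrableOn_Icc
  rw [hs.inner_traceMultiplier, traceRemainder,
    inner_mulVecOp_diagonal hs.continuousOn_traceWeightDeriv,
    Finset.mul_sum, ← Finset.sum_add_distrib]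
  trans ∑ i, (traceWeight g L H L i * z.2 i ^ 2 - traceWeight g L H 0 i * z.1 i ^ 2)
  · simp [Fin.sum_univ_two, traceWeight, hs.L_pos.ne']
    ring
  refine Finset.sum_congr rfl fun i _ => ?_
  rw [← hsq, ← integral_const_mul, ← integral_add]
  · congr 1 with x
    ring
  · exact (integrable_weight_mul_apply (continuousOn_pi.1 hs.continuousOn_traceWeight i) _ _
      i).const_mul 2
  · exact integrable_weight_mul_apply (continuousOn_pi.1 hs.continuousOn_traceWeightDeriv i) _ _ i

theorem exists_norm_sq_le_of_mem_fluxGraph :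
    ∃ (N : State L →L[ℝ] State L) (C : ℝ), (N : State L →ₗ[ℝ] State L).IsSymmetric ∧
      ∀ w v z, (w, v, z) ∈ hs.fluxGraph α₁ α₂ β₁ β₂ →
        ‖z‖ ^ 2 ≤ 2 * inner ℝ (N v) w + C * ‖w‖ ^ 2 := by
  obtain ⟨k, hk, hkg, hk0, hkL⟩ : ∃ k > 0, k ≤ g ∧ k ≤ H 0 ∧ k ≤ H L :=
    ⟨min g (min (H 0) (H L)), lt_min hs.g_pos (lt_min (hs.H_pos 0 (left_mem_Icc.2 hs.L_pos.le))
      (hs.H_pos L (right_mem_Icc.2 hs.L_pos.le))), by simp⟩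
  refine ⟨k⁻¹ • hs.traceMultiplier, k⁻¹ * (‖hs.traceRemainder‖ * ‖hs.fluxOp‖ ^ 2),
    hs.isSymmetric_traceMultiplier.smul (conj_trivial _), fun w v z h => ?_⟩
  have hremainder : inner ℝ (hs.fluxOp w) (hs.traceRemainder (hs.fluxOp w)) ≤
      ‖hs.traceRemainder‖ * ‖hs.fluxOp‖ ^ 2 * ‖w‖ ^ 2 := by
    calc inner ℝ (hs.fluxOp w) (hs.traceRemainder (hs.fluxOp w))
        ≤ ‖hs.fluxOp w‖ * (‖hs.traceRemainder‖ * ‖hs.fluxOp w‖) :=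
          (real_inner_le_norm _ _).trans (by gcongr; exact hs.traceRemainder.le_opNorm _)
      _ = ‖hs.traceRemainder‖ * ‖hs.fluxOp w‖ ^ 2 := by ring
      _ ≤ ‖hs.traceRemainder‖ * (‖hs.fluxOp‖ * ‖w‖) ^ 2 := by
          gcongr
          exact hs.fluxOp.le_opNorm w
      _ = _ := by ring
  have htraces : k * ‖z‖ ^ 2 ≤ 2 * inner ℝ (hs.traceMultiplier v) w +
      ‖hs.traceRemainder‖ * ‖hs.fluxOp‖ ^ 2 * ‖w‖ ^ 2 := by
    calc k * ‖z‖ ^ 2 ≤ k * (z.1 0 ^ 2 + z.1 1 ^ 2 + z.2 0 ^ 2 + z.2 1 ^ 2) := by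
          gcongr
          exact norm_sq_le_of_traces z
      _ = k * (z.1 0 ^ 2 + z.2 0 ^ 2) + k * z.1 1 ^ 2 + k * z.2 1 ^ 2 := by ring
      _ ≤ g * (z.1 0 ^ 2 + z.2 0 ^ 2) + H 0 * z.1 1 ^ 2 + H L * z.2 1 ^ 2 := by gcongr
      _ ≤ _ := by linarith [hs.traces_eq_of_mem_fluxGraph h]
  rw [smul_apply, real_inner_smul_left]
  calc ‖z‖ ^ 2 = k⁻¹ * (k * ‖z‖ ^ 2) := (inv_mul_cancel_left₀ hk.ne' _).symm
    _ ≤ k⁻¹ * (2 * inner ℝ (hs.traceMultiplier v) w +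
      ‖hs.traceRemainder‖ * ‖hs.fluxOp‖ ^ 2 * ‖w‖ ^ 2) := by gcongr
    _ = _ := by ring

theorem isAccretiveSystem_fluxGraph (hd : IsDissipative α₁ α₂ β₁ β₂) :
    IsAccretiveSystem (hs.fluxGraph α₁ α₂ β₁ β₂) hs.weightOp boundaryForm where
  isClosed := hs.isClosed_fluxGraph
  isSymmetric := hs.isSymmetric_weightOp
  coercive := by
    obtain ⟨c, hc, h⟩ := hs.exists_mul_norm_sq_le_wInner
    exact ⟨c, hc, fun x => (h x).trans_eq (hs.inner_weightOp x x).symm⟩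
  green _ _ _ h := hs.inner_weightOp_of_mem_fluxGraph h
  form_nonneg _ _ z h := by
    have hmem := (hs.mem_fluxGraph.1 h).2
    linarith [hd.boundaryTerm_nonpos hmem.1 hmem.2, boundaryForm_apply z]
  adjoint_accretive _ _ h := hs.inner_weightOp_symm_nonpos hd h
  dense_domain _ h := hs.eq_zero_of_orthogonal_domain h
  trace_bound := hs.exists_norm_sq_le_of_mem_fluxGraph

end IsSubcritical

end TraceBound

section WeakSolution

variable {g L T : ℝ} {U H : ℝ → ℝ} {α₁ α₂ β₁ β₂ : ℝ} {f : State L} {G q : ℝ → State L}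
  {F0 FL : ℝ → Fin 2 → ℝ}

theorem IsSubcritical.balance_integral (hs : IsSubcritical g L U H) {φ : ℝ → ℝ}
    (hφ : ContDiff ℝ ∞ φ) (i : Fin 2) {z : ℝ → Traces} {t : ℝ} (ht : t ∈ Icc 0 T)
    (hq : IntegrableOn q (Icc 0 T)) (hG : IntegrableOn G (Icc 0 T))
    (hz : IntegrableOn z (Icc 0 T)) (p : State L) :
    hs.balance hφ i (∫ τ in (0 : ℝ)..t, q τ, f - p + ∫ τ in (0 : ℝ)..t, G τ,
        ∫ τ in (0 : ℝ)..t, z τ) =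
      ((∫ x in Icc (0 : ℝ) L, f x i * φ x) +
        ∫ τ in (0 : ℝ)..t, hs.balance hφ i (q τ, G τ, z τ)) -
        ∫ x in Icc (0 : ℝ) L, p x i * φ x := by
  have hsub : Ioc 0 t ⊆ Icc 0 T := Ioc_subset_Icc_self.trans (Icc_subset_Icc_right ht.2)
  have iq := hq.mono_set hsub
  have iG := hG.mono_set hsub
  have iz := hz.mono_set hsub
  have hint : ∫ τ in (0 : ℝ)..t, (q τ, G τ, z τ) =
      (∫ τ in (0 : ℝ)..t, q τ, ∫ τ in (0 : ℝ)..t, G τ, ∫ τ in (0 : ℝ)..t, z τ) := by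
    simp only [intervalIntegral.integral_of_le ht.1]
    rw [integral_pair iq (iG.prodMk iz), integral_pair iG iz]
  have hsplit : (∫ τ in (0 : ℝ)..t, q τ, f - p + ∫ τ in (0 : ℝ)..t, G τ, ∫ τ in (0 : ℝ)..t, z τ) =
      (∫ τ in (0 : ℝ)..t, (q τ, G τ, z τ)) + (0, f - p, 0) := by
    rw [hint, Prod.mk_add_mk, Prod.mk_add_mk, add_zero, add_zero, add_comm]
  have hdata : hs.balance hφ i (0, f - p, 0) =
      (∫ x in Icc (0 : ℝ) L, f x i * φ x) - ∫ x in Icc (0 : ℝ) L, p x i * φ x := by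
    simp only [IsSubcritical.balance, ContinuousLinearMap.coprod_apply, map_zero, map_sub,
      testPairing_apply, zero_add, add_zero]
  rw [hsplit, map_add, hdata, ← (hs.balance hφ i).intervalIntegral_comp_comm
    ((intervalIntegrable_iff_integrableOn_Ioc_of_le ht.1).2 (iq.prodMk (iG.prodMk iz)))]
  ring

theorem ae_apply_eq_zero_iff_apply_integral_eq_zero {Z : Type*} [NormedAddCommGroup Z]
    [NormedSpace ℝ Z] [CompleteSpace Z] (κ : Z →L[ℝ] ℝ) {z : ℝ → Z}
    (hz : IntegrableOn z (Icc 0 T)) :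
    (∀ᵐ τ ∂(volume.restrict (Icc 0 T)), κ (z τ) = 0) ↔
      ∀ t ∈ Icc 0 T, κ (∫ τ in (0 : ℝ)..t, z τ) = 0 := by
  have hcomm : ∀ t ∈ Icc 0 T, ∫ τ in (0 : ℝ)..t, κ (z τ) = κ (∫ τ in (0 : ℝ)..t, z τ) :=
    fun t ht => κ.intervalIntegral_comp_comm (intervalIntegrable_of_Icc ht hz)
  refine ⟨fun h t ht => ?_, fun h => ?_⟩
  · rw [← hcomm t ht, intervalIntegral_congr_Icc ht h, intervalIntegral.integral_zero]
  · exact ae_eq_zero_of_primitive_eq_zero (κ.integrable_comp hz)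
      fun t ht => (hcomm t ht).trans (h t ht)

theorem memLp_traces_iff {μ : Measure ℝ} :
    MemLp (fun τ => ((F0 τ, FL τ) : Traces)) 2 μ ↔
      (∀ i, MemLp (fun τ => F0 τ i) 2 μ) ∧ ∀ i, MemLp (fun τ => FL τ i) 2 μ := by
  rw [← memLp_pi_iff, ← memLp_pi_iff, memLp_prod_iff]

theorem IsSubcritical.integral_mem_fluxGraph_iff (hs : IsSubcritical g L U H)
    (hq : IntegrableOn q (Icc 0 T)) (hG : IntegrableOn G (Icc 0 T))
    (hz : IntegrableOn (fun τ => ((F0 τ, FL τ) : Traces)) (Icc 0 T)) :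
    (∀ t ∈ Icc 0 T, (∫ τ in (0 : ℝ)..t, q τ, f - q t + ∫ τ in (0 : ℝ)..t, G τ,
        ∫ τ in (0 : ℝ)..t, ((F0 τ, FL τ) : Traces)) ∈ hs.fluxGraph α₁ α₂ β₁ β₂) ↔
      (∀ φ : ℝ → ℝ, ContDiff ℝ ∞ φ → ∀ i : Fin 2, ∀ t ∈ Icc 0 T,
        ∫ x in Icc (0 : ℝ) L, q t x i * φ x =
          (∫ x in Icc (0 : ℝ) L, f x i * φ x) +
          ∫ τ in (0 : ℝ)..t,
            ((∫ x in Icc (0 : ℝ) L, flux g U H (q τ) x i * deriv φ x) +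
              (∫ x in Icc (0 : ℝ) L, G τ x i * φ x) +
              F0 τ i * φ 0 - FL τ i * φ L)) ∧
        (∀ᵐ τ ∂(volume.restrict (Icc 0 T)), α₁ * F0 τ 0 + α₂ * F0 τ 1 = 0) ∧
        ∀ᵐ τ ∂(volume.restrict (Icc 0 T)), β₁ * FL τ 0 - β₂ * FL τ 1 = 0 := by
  have hbcZero := ae_apply_eq_zero_iff_apply_integral_eq_zero (bcZero α₁ α₂) hz
  have hbcL := ae_apply_eq_zero_iff_apply_integral_eq_zero (bcL β₁ β₂) hz
  refine Iff.trans ?_ (and_congr_right' (and_congr hbcZero hbcL)).symm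
  simp only [IsSubcritical.fluxGraph, Submodule.mem_inf, Submodule.mem_iInf, LinearMap.mem_ker,
    ContinuousLinearMap.coe_coe, and_assoc, forall_and]
  refine and_congr ?_ Iff.rfl
  constructor
  · intro h φ hφ i t ht
    have := h t ht φ hφ i
    rw [hs.balance_integral hφ i ht hq hG hz, sub_eq_zero] at this
    simpa only [hs.balance_apply] using this.symm
  · intro h t ht φ hφ i
    rw [hs.balance_integral hφ i ht hq hG hz, sub_eq_zero, h φ hφ i t ht]
    simp only [hs.balance_apply]

theorem isWeakSolution_iff_isMildSolution (hs : IsSubcritical g L U H)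
    (hG : IntegrableOn G (Icc 0 T)) :
    IsWeakSolution g L U H α₁ α₂ β₁ β₂ T f G q F0 FL ↔
      IsMildSolution (hs.fluxGraph α₁ α₂ β₁ β₂) T f G q fun τ => (F0 τ, FL τ) := by
  constructor
  · intro h
    have hz := memLp_traces_iff.2 ⟨h.trace_zero, h.trace_L⟩
    exact ⟨h.continuousOn, h.initial, hz,
      (hs.integral_mem_fluxGraph_iff h.continuousOn.integrableOn_Icc hG
        (hz.integrable one_le_two)).2 ⟨h.weak_form, h.bc_zero, h.bc_L⟩⟩
  · intro h
    obtain ⟨htrace_zero, htrace_L⟩ := memLp_traces_iff.1 h.memLp_trace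
    obtain ⟨hweak, hbc_zero, hbc_L⟩ :=
      (hs.integral_mem_fluxGraph_iff h.continuousOn.integrableOn_Icc hG
        (h.memLp_trace.integrable one_le_two)).1 h.mem
    exact ⟨h.continuousOn, h.initial, htrace_zero, htrace_L, hweak, hbc_zero, hbc_L⟩

end WeakSolution

section Estimate

variable {g L T : ℝ} {U H : ℝ → ℝ} {α₁ α₂ β₁ β₂ : ℝ} {f : State L} {G q : ℝ → State L}
  {F0 FL : ℝ → Fin 2 → ℝ}

theorem IsForcing.memLp (hG : IsForcing g U H T G) (hs : IsSubcritical g L U H) :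
    MemLp G 2 (volume.restrict (Icc 0 T)) := by
  obtain ⟨c, hc, hcoer⟩ := hs.exists_mul_norm_sq_le_wInner
  obtain ⟨B, hB⟩ := hG.bddAbove
  refine MemLp.of_bound hG.aestronglyMeasurable √(B ^ 2 / c)
    ((ae_restrict_mem measurableSet_Icc).mono fun τ hτ => Real.le_sqrt_of_sq_le ?_)
  rw [le_div_iff₀' hc]
  calc c * ‖G τ‖ ^ 2 ≤ wNorm g U H (G τ) ^ 2 := (hcoer (G τ)).trans_eq (hs.wNorm_sq _).symm
    _ ≤ B ^ 2 := pow_le_pow_left₀ (Real.sqrt_nonneg _) (hB (mem_image_of_mem _ hτ)) 2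

theorem forcingSup_nonneg (G : ℝ → State L) (t : ℝ) : 0 ≤ forcingSup g U H G t :=
  Real.sSup_nonneg (forall_mem_image.2 fun _ _ => Real.sqrt_nonneg _)

theorem IsForcing.wNorm_le_forcingSup (hG : IsForcing g U H T G) {t τ : ℝ} (ht : t ≤ T)
    (hτ : τ ∈ Icc 0 t) : wNorm g U H (G τ) ≤ forcingSup g U H G t :=
  le_csSup (hG.bddAbove.mono (image_mono (Icc_subset_Icc_right ht))) (mem_image_of_mem _ hτ)

theorem IsSubcritical.continuousOn_wInner (hs : IsSubcritical g L U H)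
    (hq : ContinuousOn q (Icc 0 T)) :
    ContinuousOn (fun τ => wInner g U H (q τ) (q τ)) (Icc 0 T) := by
  simp only [← hs.inner_weightOp]
  exact (hs.weightOp.continuous.comp_continuousOn hq).inner hq

theorem IsSubcritical.integrableOn_wInner (hs : IsSubcritical g L U H)
    (hG : MemLp G 2 (volume.restrict (Icc 0 T))) (hq : ContinuousOn q (Icc 0 T)) :
    IntegrableOn (fun τ => wInner g U H (G τ) (q τ)) (Icc 0 T) := by
  simp only [← hs.inner_weightOp]
  exact memLp_one_iff_integrable.1
    (((innerSL ℝ (E := State L)).comp (hs.weightOp : State L →L[ℝ] State L)).memLp_of_bilin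
      1 hG (memLp_of_continuousOn 2 hq))

namespace IsWeakSolution

theorem integrableOn_boundaryTerm (h : IsWeakSolution g L U H α₁ α₂ β₁ β₂ T f G q F0 FL) :
    IntegrableOn (boundaryTerm F0 FL) (Icc 0 T) :=
  ((h.trace_zero 0).integrable_mul (h.trace_zero 1)).sub
    ((h.trace_L 0).integrable_mul (h.trace_L 1))

theorem boundaryTerm_nonpos (h : IsWeakSolution g L U H α₁ α₂ β₁ β₂ T f G q F0 FL)
    (hd : IsDissipative α₁ α₂ β₁ β₂) :
    ∀ᵐ τ ∂(volume.restrict (Icc 0 T)), boundaryTerm F0 FL τ ≤ 0 := by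
  filter_upwards [h.bc_zero, h.bc_L] with τ h0 hL
  exact hd.boundaryTerm_nonpos h0 hL

theorem boundaryTerm_le (h : IsWeakSolution g L U H α₁ α₂ β₁ β₂ T f G q F0 FL)
    (hs : IsSubcritical g L U H) (hd : IsDissipative α₁ α₂ β₁ β₂) {t μ : ℝ} (ht : t ∈ Icc 0 T)
    (hμ : ∀ᵐ τ ∂(volume.restrict (Icc 0 t)), q τ ≠ 0 →
      boundaryTerm F0 FL τ / wNorm g U H (q τ) ^ 2 ≤ μ) :
    ∀ᵐ τ ∂(volume.restrict (Icc 0 t)), boundaryTerm F0 FL τ ≤ μ * wInner g U H (q τ) (q τ) := by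
  filter_upwards [hμ, ae_restrict_of_ae_restrict_of_subset (Icc_subset_Icc_right ht.2)
    (h.boundaryTerm_nonpos hd)] with τ hτ hneg
  by_cases hq : q τ = 0
  · rwa [hq, ← hs.inner_weightOp, inner_zero_right, mul_zero]
  · rw [← hs.wNorm_sq]
    exact (div_le_iff₀ (pow_pos (hs.wNorm_pos hq) 2)).1 (hτ hq)

theorem energy_eq (h : IsWeakSolution g L U H α₁ α₂ β₁ β₂ T f G q F0 FL)
    (hs : IsSubcritical g L U H) (hd : IsDissipative α₁ α₂ β₁ β₂) (hT : 0 < T)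
    (hG : MemLp G 2 (volume.restrict (Icc 0 T))) {t : ℝ} (ht : t ∈ Icc 0 T) :
    wInner g U H (q t) (q t) - wInner g U H f f =
      ∫ τ in (0 : ℝ)..t, 2 * (boundaryTerm F0 FL τ + wInner g U H (G τ) (q τ)) := by
  have henergy := ((isWeakSolution_iff_isMildSolution hs (hG.integrable one_le_two)).1 h).energy_eq
    (hs.isAccretiveSystem_fluxGraph hd) hT hG ht
  rw [hs.inner_weightOp, hs.inner_weightOp] at henergy
  refine henergy.trans (intervalIntegral.integral_congr fun τ _ => ?_)
  simp only [hs.inner_weightOp, boundaryForm_apply, boundaryTerm]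
  ring

theorem energy_sub_le (h : IsWeakSolution g L U H α₁ α₂ β₁ β₂ T f G q F0 FL)
    (hs : IsSubcritical g L U H) (hd : IsDissipative α₁ α₂ β₁ β₂) (hT : 0 < T)
    (hG : IsForcing g U H T G) {t μ : ℝ} (ht : t ∈ Icc 0 T)
    (hμ : ∀ᵐ τ ∂(volume.restrict (Icc 0 t)),
      boundaryTerm F0 FL τ ≤ μ * wInner g U H (q τ) (q τ))
    {s s' : ℝ} (hst : s ∈ Icc 0 t) (hs' : s' ∈ Icc s t) :
    wInner g U H (q s') (q s') - wInner g U H (q s) (q s) ≤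
      ∫ τ in s..s', (2 * μ * wInner g U H (q τ) (q τ) +
        2 * forcingSup g U H G t * √(wInner g U H (q τ) (q τ))) := by
  have hmem := hG.memLp hs
  have hint : ∀ r ∈ Icc 0 T, IntervalIntegrable
      (fun τ => 2 * (boundaryTerm F0 FL τ + wInner g U H (G τ) (q τ))) volume 0 r := fun r hr =>
    intervalIntegrable_of_Icc hr ((h.integrableOn_boundaryTerm.add
      (hs.integrableOn_wInner hmem h.continuousOn)).const_mul 2)
  have hsT : s ∈ Icc 0 T := Icc_subset_Icc_right ht.2 hst
  have hsT' : s' ∈ Icc 0 T := ⟨hst.1.trans hs'.1, hs'.2.trans ht.2⟩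
  have hdiff : wInner g U H (q s') (q s') - wInner g U H (q s) (q s) =
      ∫ τ in s..s', 2 * (boundaryTerm F0 FL τ + wInner g U H (G τ) (q τ)) := by
    rw [← intervalIntegral.integral_interval_sub_left (hint s' hsT') (hint s hsT),
      ← h.energy_eq hs hd hT hmem hsT', ← h.energy_eq hs hd hT hmem hsT, sub_sub_sub_cancel_right]
  have hsub : Icc s s' ⊆ Icc 0 t := Icc_subset_Icc hst.1 hs'.2
  have hcont : ContinuousOn (fun τ => wInner g U H (q τ) (q τ)) (uIcc s s') :=
    (hs.continuousOn_wInner h.continuousOn).mono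
      (uIcc_of_le hs'.1 ▸ hsub.trans (Icc_subset_Icc_right ht.2))
  rw [hdiff]
  refine intervalIntegral.integral_mono_ae_restrict hs'.1 ((hint s hsT).symm.trans (hint s' hsT'))
    (ContinuousOn.intervalIntegrable (by fun_prop)) ?_
  filter_upwards [ae_restrict_of_ae_restrict_of_subset hsub hμ,
    ae_restrict_mem measurableSet_Icc] with τ hτ hmτ
  have hforcing : wInner g U H (G τ) (q τ) ≤
      forcingSup g U H G t * √(wInner g U H (q τ) (q τ)) :=
    (hs.wInner_le (G τ) (q τ)).trans (mul_le_mul_of_nonneg_right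
      (hG.wNorm_le_forcingSup ht.2 (hsub hmτ)) (Real.sqrt_nonneg _))
  linarith

theorem wNorm_le (h : IsWeakSolution g L U H α₁ α₂ β₁ β₂ T f G q F0 FL)
    (hs : IsSubcritical g L U H) (hd : IsDissipative α₁ α₂ β₁ β₂) (hT : 0 < T)
    (hG : IsForcing g U H T G) {t μ : ℝ} (ht : t ∈ Icc 0 T)
    (hμ : ∀ᵐ τ ∂(volume.restrict (Icc 0 t)), q τ ≠ 0 →
      boundaryTerm F0 FL τ / wNorm g U H (q τ) ^ 2 ≤ μ) :
    wNorm g U H (q t) ≤ growthFactor μ t * Real.exp (μ * t) *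
      (wNorm g U H f + forcingSup g U H G t) := by
  have hS := forcingSup_nonneg (g := g) (U := U) (H := H) G t
  have hcont := (hs.continuousOn_wInner h.continuousOn).mono (Icc_subset_Icc_right ht.2)
  have hBT := h.boundaryTerm_le hs hd ht hμ
  have hgronwall := sqrt_le_gronwallBound ht.1 hS hcont (hs.wInner_nonneg (q 0))
    fun s hst s' hs' => h.energy_sub_le hs hd hT hG ht hBT hst hs'
  rw [h.initial] at hgronwall
  exact hgronwall.trans (gronwallBound_le_growthFactor (Real.sqrt_nonneg _) hS)

end IsWeakSolution

theorem growthFactor_zero_le_exp {t : ℝ} (ht : 0 ≤ t) : growthFactor 0 t ≤ Real.exp t := by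
  rw [growthFactor, if_pos rfl]
  exact max_le (Real.one_le_exp ht) (by linarith [Real.add_one_le_exp t])

theorem stronglyWellPosed (hs : IsSubcritical g L U H) (hd : IsDissipative α₁ α₂ β₁ β₂) :
    StronglyWellPosed g L U H α₁ α₂ β₁ β₂ := by
  refine ⟨1, one_pos, 1, fun T hT f G hG => ?_⟩
  have hD := hs.isAccretiveSystem_fluxGraph hd
  have hmild {q : ℝ → State L} {F0 FL : ℝ → Fin 2 → ℝ} :=
    isWeakSolution_iff_isMildSolution (f := f) (q := q) (F0 := F0) (FL := FL)
      (α₁ := α₁) (α₂ := α₂) (β₁ := β₁) (β₂ := β₂) hs ((hG.memLp hs).integrable one_le_two)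
  obtain ⟨q, z, hq, -⟩ := exists_isMildSolution hD hT f (hG.memLp hs)
  have hsol : IsWeakSolution g L U H α₁ α₂ β₁ β₂ T f G q (fun τ => (z τ).1) fun τ => (z τ).2 :=
    hmild.2 hq
  refine ⟨q, ⟨_, _, hsol⟩, fun p ⟨_, _, hp⟩ => ((hmild.1 hp).unique hD hT hq).1, fun t ht => ?_⟩
  have hμ : ∀ᵐ τ ∂(volume.restrict (Icc 0 t)), q τ ≠ 0 →
      boundaryTerm (fun τ => (z τ).1) (fun τ => (z τ).2) τ / wNorm g U H (q τ) ^ 2 ≤ 0 :=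
    (ae_restrict_of_ae_restrict_of_subset (Icc_subset_Icc_right ht.2)
      (hsol.boundaryTerm_nonpos hd)).mono fun _ hτ _ =>
        div_nonpos_of_nonpos_of_nonneg hτ (sq_nonneg _)
  refine (hsol.wNorm_le hs hd hT hG ht hμ).trans (mul_le_mul_of_nonneg_right ?_
    (add_nonneg (Real.sqrt_nonneg _) (forcingSup_nonneg G t)))
  rw [zero_mul, Real.exp_zero, mul_one, one_mul, one_mul]
  exact growthFactor_zero_le_exp ht.1

end Estimate

end LinearSWE

end

theorem theorem2_general (g L : ℝ) (hg : 0 < g) (hL : 0 < L) (U H : ℝ → ℝ)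
    (hU : ContinuousOn U (Icc 0 L)) (hH : ContDiffOn ℝ 1 H (Icc 0 L))
    (hHpos : ∀ x ∈ Icc 0 L, 0 < H x)
    (hFr : ∀ x ∈ Icc 0 L, |U x| / √(g * H x) < 1)
    (α₁ α₂ β₁ β₂ : ℝ) (hα₁ : 0 ≤ α₁) (hα₂ : 0 ≤ α₂) (hβ₁ : 0 ≤ β₁) (hβ₂ : 0 ≤ β₂)
    (hα : (α₁, α₂) ≠ (0, 0)) (hβ : (β₁, β₂) ≠ (0, 0)) :
    LinearSWE.StronglyWellPosed g L U H α₁ α₂ β₁ β₂ ∧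
    ∀ T > (0 : ℝ), ∀ (f : LinearSWE.State L) (G q : ℝ → LinearSWE.State L)
      (F0 FL : ℝ → Fin 2 → ℝ), LinearSWE.IsForcing g U H T G →
      LinearSWE.IsWeakSolution g L U H α₁ α₂ β₁ β₂ T f G q F0 FL →
      (∀ᵐ τ ∂(volume.restrict (Icc 0 T)), LinearSWE.boundaryTerm F0 FL τ ≤ 0) ∧
      ∀ t ∈ Icc 0 T, ∀ μ : ℝ,
        (∀ᵐ τ ∂(volume.restrict (Icc 0 t)), q τ ≠ 0 →
          LinearSWE.boundaryTerm F0 FL τ / LinearSWE.wNorm g U H (q τ) ^ 2 ≤ μ) →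
        LinearSWE.wNorm g U H (q t) ≤
          LinearSWE.growthFactor μ t * Real.exp (μ * t) *
            (LinearSWE.wNorm g U H f + LinearSWE.forcingSup g U H G t) := by
  have hs := LinearSWE.isSubcritical_of_froude_lt_one hg hL hU hH hHpos hFr
  have hd : LinearSWE.IsDissipative α₁ α₂ β₁ β₂ := ⟨hα₁, hα₂, hβ₁, hβ₂, hα, hβ⟩
  exact ⟨LinearSWE.stronglyWellPosed hs hd, fun T hT f G q F0 FL hG h =>
    ⟨h.boundaryTerm_nonpos hd, fun t ht μ hμ => h.wNorm_le hs hd hT hG ht hμ⟩⟩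

theorem theorem2 (g L : ℝ) (hg : 0 < g) (hL : 0 < L) (U H : ℝ → ℝ)
    (hU : ContDiffOn ℝ 1 U (Icc 0 L)) (hH : ContDiffOn ℝ 1 H (Icc 0 L))
    (hHpos : ∀ x ∈ Icc 0 L, 0 < H x)
    (hFr : ∀ x ∈ Icc 0 L, |U x| / √(g * H x) < 1)
    (α₁ α₂ β₁ β₂ : ℝ) (hα₁ : 0 ≤ α₁) (hα₂ : 0 ≤ α₂) (hβ₁ : 0 ≤ β₁) (hβ₂ : 0 ≤ β₂)
    (hα : (α₁, α₂) ≠ (0, 0)) (hβ : (β₁, β₂) ≠ (0, 0)) :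
    LinearSWE.StronglyWellPosed g L U H α₁ α₂ β₁ β₂ ∧
    ∀ T > (0 : ℝ), ∀ (f : LinearSWE.State L) (G q : ℝ → LinearSWE.State L)
      (F0 FL : ℝ → Fin 2 → ℝ), LinearSWE.IsForcing g U H T G →
      LinearSWE.IsWeakSolution g L U H α₁ α₂ β₁ β₂ T f G q F0 FL →
      (∀ᵐ τ ∂(volume.restrict (Icc 0 T)), LinearSWE.boundaryTerm F0 FL τ ≤ 0) ∧
      ∀ t ∈ Icc 0 T, ∀ μ : ℝ,
        (∀ᵐ τ ∂(volume.restrict (Icc 0 t)), q τ ≠ 0 →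
          LinearSWE.boundaryTerm F0 FL τ / LinearSWE.wNorm g U H (q τ) ^ 2 ≤ μ) →
        LinearSWE.wNorm g U H (q t) ≤
          LinearSWE.growthFactor μ t * Real.exp (μ * t) *
            (LinearSWE.wNorm g U H f + LinearSWE.forcingSup g U H G t) :=
  theorem2_general g L hg hL U H hU.continuousOn hH hHpos hFr α₁ α₂ β₁ β₂ hα₁ hα₂ hβ₁ hβ₂ hα hβ
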